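/- A lattice polygon is a two-dimensional polygon $P\subset\mathbb R^2$ that is the convex hull of finitely many points of $\mathbb Z^2$. It is called smooth if every cone of its normal fan is unimodular, i.e. generated by a part of a basis of $\mathbb Z^2$. Two lattice polygons are integrally equivalent if some affine map of $\mathbb R^2$ maps $\mathbb Z^2$ bijectively onto $\mathbb Z^2$ and maps one polygon onto the other. The (lattice) length of an edge of a lattice polygon is the number of lattice points on it minus one. (1) For every integer $N\ge 0$ there are, up to integral equivalence, only finitely many smooth lattice polygons with exactly $N+1$ lattice points on their boundary. (2) Let $P$ be a smooth lattice polygon, let $a$ be its number of vertices and $b$ the maximal length of an edge of $P$. Then the Euclidean area of $P$ satisfies $$\operatorname{vol}(P)\le\begin{cases}\tfrac12 b^2, & a=3,\\ b^2, & a=4,\\ 4^{a-4}b^2-a+4, & a\ge 5.\end{cases}$$ -/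

import Mathlib

open MeasureTheory

/-- The lattice `ℤ^d`, as a subset of `ℝ^d`. -/
def intLattice (d : ℕ) : Set (Fin d → ℝ) :=
  Set.range fun (z : Fin d → ℤ) (i : Fin d) => (z i : ℝ)

/-- A lattice polytope in `ℝ^d`: the convex hull of a nonempty finite set of lattice points. -/
def IsLatticePolytope {d : ℕ} (P : Set (Fin d → ℝ)) : Prop :=
  ∃ V : Set (Fin d → ℝ), V.Finite ∧ V.Nonempty ∧ V ⊆ intLattice d ∧ P = convexHull ℝ V

/-- A lattice polygon: a lattice polytope of full dimension in the plane. -/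
def IsLatticePolygon (P : Set (Fin 2 → ℝ)) : Prop :=
  IsLatticePolytope P ∧ affineSpan ℝ P = ⊤

/-- The nonempty faces of a polytope `P` (including `P` itself): the nonempty subsets on which
some linear functional attains its maximum over `P`. -/
def IsFace {d : ℕ} (P F : Set (Fin d → ℝ)) : Prop :=
  F.Nonempty ∧ IsExposed ℝ P F

/-- The (inner) normal cone of `P` along `F`: the functionals, written as vectors through the
standard pairing, that attain their minimum over `P` at every point of `F`.  For a vertex `u`,
the normal cone along `{u}` is the dual of the tangent cone of `P` at `u`. -/
def normalCone {d : ℕ} (P F : Set (Fin d → ℝ)) : Set (Fin d → ℝ) :=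
  {w | ∀ y ∈ F, ∀ x ∈ P, w ⬝ᵥ y ≤ w ⬝ᵥ x}

/-- The normal fan of `P`: the set of normal cones of all nonempty faces of `P`. -/
def normalFan {d : ℕ} (P : Set (Fin d → ℝ)) : Set (Set (Fin d → ℝ)) :=
  {σ | ∃ F, IsFace P F ∧ σ = normalCone P F}

/-- A cone is unimodular if it is generated by (a part of) a basis of the lattice `ℤ^d`.
The chosen part consists then of the primitive minimal generators of the cone; for a cone of
full dimension it is the whole basis. -/
def IsUnimodularCone {d : ℕ} (σ : Set (Fin d → ℝ)) : Prop :=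
  ∃ (e : Module.Basis (Fin d) ℤ (Fin d → ℤ)) (S : Set (Fin d)),
    σ = (PointedCone.hull ℝ ((fun (j : Fin d) (i : Fin d) => (e j i : ℝ)) '' S) :
      Set (Fin d → ℝ))

/-- A polytope is smooth if every cone in its normal fan is unimodular. -/
def IsSmoothPolytope {d : ℕ} (P : Set (Fin d → ℝ)) : Prop :=
  ∀ σ ∈ normalFan P, IsUnimodularCone σ

/-- Smooth lattice polygons. -/
def IsSmoothPolygon (P : Set (Fin 2 → ℝ)) : Prop :=
  IsLatticePolygon P ∧ IsSmoothPolytope P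

/-- Integral equivalence: some affine map sends `P` onto `P'` and the lattice points of the affine
span of `P` bijectively to those of the affine span of `P'`.  (Every affine map between the affine
spans is the restriction of an affine map between the ambient spaces.) -/
def IntegrallyEquivalent {d d' : ℕ} (P : Set (Fin d → ℝ)) (P' : Set (Fin d' → ℝ)) : Prop :=
  ∃ f : (Fin d → ℝ) →ᵃ[ℝ] (Fin d' → ℝ),
    Set.BijOn f (intLattice d ∩ (affineSpan ℝ P : Set (Fin d → ℝ)))
      (intLattice d' ∩ (affineSpan ℝ P' : Set (Fin d' → ℝ))) ∧
    f '' P = P'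

/-- The number of vertices of `P`. -/
noncomputable def numVertices {d : ℕ} (P : Set (Fin d → ℝ)) : ℕ :=
  (P.extremePoints ℝ).ncard

/-- The edges of `P`: its faces of dimension one. -/
def IsEdge {d : ℕ} (P F : Set (Fin d → ℝ)) : Prop :=
  IsFace P F ∧ Module.finrank ℝ (vectorSpan ℝ F) = 1

/-- The lattice length of a lattice segment: one less than its number of lattice points. -/
noncomputable def latticeLength {d : ℕ} (F : Set (Fin d → ℝ)) : ℕ :=
  (F ∩ intLattice d).ncard - 1

/-- The set of lattice lengths of the edges of `P`. -/
def edgeLengths {d : ℕ} (P : Set (Fin d → ℝ)) : Set ℕ :=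
  {l | ∃ F, IsEdge P F ∧ latticeLength F = l}

/-- The number of lattice points on the boundary of a polygon. -/
noncomputable def numBoundaryLatticePoints (P : Set (Fin 2 → ℝ)) : ℕ :=
  (frontier P ∩ intLattice 2).ncard

/-!
The inner normals of a smooth polygon, in cyclic order, form a smooth fan: consecutive primitive
generators have determinant `1`. A fan with at least five rays has a ray generated by the sum of its
two neighbours. Dropping the corresponding inequality enlarges the polygon to a smooth one with one
vertex less, and lengthens only the two edges next to the dropped one, each by the length of the
latter; so the maximal edge length at most doubles. A smooth quadrilateral is a trapezoid whose two
legs have the same lattice length, namely the lattice distance of the parallel edges; it fits into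
a box with sides a leg and the longer parallel edge. A smooth triangle is a multiple of the standard
one. The two edges that the reduction from five vertices to four lengthens become adjacent, so one
of the opposite legs keeps its length and only the other side of the box doubles.

Thus the polygon lies in a unimodular image of a box whose size depends only on the number of
vertices and the maximal edge length, which bounds the area. Both are bounded by the number of
boundary lattice points, and a box contains only finitely many lattice polygons.
-/

/-! ### Plane determinants and lattice vectors -/

/-- The determinant of the `2 × 2` matrix with columns `u` and `v`, i.e. the oriented area of the
parallelogram that they span. -/
def planeDet {R : Type*} [CommRing R] (u v : Fin 2 → R) : R :=
  u 0 * v 1 - u 1 * v 0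

section PlaneDet

variable {R : Type*} [CommRing R]

lemma planeDet_self (u : Fin 2 → R) : planeDet u u = 0 := by
  simp only [planeDet]; ring

lemma planeDet_swap (u v : Fin 2 → R) : planeDet v u = -planeDet u v := by
  simp only [planeDet]; ring

lemma planeDet_add_left (u v w : Fin 2 → R) :
    planeDet (u + v) w = planeDet u w + planeDet v w := by
  simp only [planeDet, Pi.add_apply]; ring

lemma planeDet_add_right (u v w : Fin 2 → R) :
    planeDet u (v + w) = planeDet u v + planeDet u w := by
  simp only [planeDet, Pi.add_apply]; ring

lemma planeDet_neg_left (u v : Fin 2 → R) : planeDet (-u) v = -planeDet u v := by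
  simp only [planeDet, Pi.neg_apply]; ring

lemma planeDet_neg_right (u v : Fin 2 → R) : planeDet u (-v) = -planeDet u v := by
  simp only [planeDet, Pi.neg_apply]; ring

lemma planeDet_sub_left (u v w : Fin 2 → R) :
    planeDet (u - v) w = planeDet u w - planeDet v w := by
  simp only [planeDet, Pi.sub_apply]; ring

lemma planeDet_sub_right (u v w : Fin 2 → R) :
    planeDet u (v - w) = planeDet u v - planeDet u w := by
  simp only [planeDet, Pi.sub_apply]; ring

lemma planeDet_smul_left (k : R) (u v : Fin 2 → R) :
    planeDet (k • u) v = k * planeDet u v := by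
  simp only [planeDet, Pi.smul_apply, smul_eq_mul]; ring

lemma planeDet_smul_right (k : R) (u v : Fin 2 → R) :
    planeDet u (k • v) = k * planeDet u v := by
  simp only [planeDet, Pi.smul_apply, smul_eq_mul]; ring

lemma planeDet_smul_add_planeDet_smul (a b x : Fin 2 → R) :
    planeDet x b • a + planeDet a x • b = planeDet a b • x := by
  ext i
  fin_cases i <;> simp [planeDet] <;> ring

lemma eq_planeDet_smul_add {a b : Fin 2 → R} (hab : planeDet a b = 1) (x : Fin 2 → R) :
    x = planeDet x b • a + planeDet a x • b := by
  rw [planeDet_smul_add_planeDet_smul, hab, one_smul]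

lemma add_eq_planeDet_smul {u v w : Fin 2 → R} (huv : planeDet u v = 1)
    (hvw : planeDet v w = 1) : u + w = planeDet u w • v := by
  have h := planeDet_smul_add_planeDet_smul u v w
  rw [huv, planeDet_swap, hvw, one_smul, neg_one_smul] at h
  linear_combination (norm := module) (-1 : R) • h

/-- The vector `m` turned clockwise by a right angle; in the plane it spans the kernel of
`m ⬝ᵥ ·`. -/
def rot (m : Fin 2 → R) : Fin 2 → R :=
  ![m 1, -m 0]

lemma planeDet_smul_eq_rot (p m v : Fin 2 → R) :
    planeDet p m • v = (p ⬝ᵥ v) • rot m - (m ⬝ᵥ v) • rot p := by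
  ext i
  fin_cases i <;> simp [planeDet, rot, dotProduct, Fin.sum_univ_two] <;> ring

lemma rot_ne_zero [Nontrivial R] {p m : Fin 2 → R} (hpm : planeDet p m = 1) : rot m ≠ 0 := by
  intro h
  have h₀ := congrFun h 0
  have h₁ := congrFun h 1
  simp only [rot, Matrix.cons_val_zero, Matrix.cons_val_one, Pi.zero_apply, neg_eq_zero] at h₀ h₁
  simp [planeDet, h₀, h₁] at hpm

lemma eq_of_dotProduct_eq {p m x y : Fin 2 → R} (hpm : planeDet p m = 1)
    (hp : p ⬝ᵥ x = p ⬝ᵥ y) (hm : m ⬝ᵥ x = m ⬝ᵥ y) : x = y := by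
  rw [← one_smul R x, ← one_smul R y, ← hpm, planeDet_smul_eq_rot, planeDet_smul_eq_rot, hp, hm]

lemma eq_zero_of_planeDet_eq_zero [IsDomain R] {u v w : Fin 2 → R} (huv : planeDet u v ≠ 0)
    (hu : planeDet u w = 0) (hv : planeDet v w = 0) : w = 0 := by
  have h := planeDet_smul_add_planeDet_smul u v w
  rw [hu, planeDet_swap, hv, neg_zero, zero_smul, zero_smul, zero_add] at h
  exact (smul_eq_zero.1 h.symm).resolve_left huv

end PlaneDet

lemma eq_of_planeDet_eq_zero {u v u' v' : Fin 2 → ℤ} (hu : planeDet u u' = 1)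
    (hv : planeDet v v' = 1) (h : planeDet u v = 0) (hpos : 0 < planeDet v u') : v = u := by
  have hvu : v = planeDet v u' • u := by
    simpa only [h, zero_smul, add_zero] using eq_planeDet_smul_add hu v
  have hunit : planeDet v u' * planeDet u v' = 1 := by
    rw [← planeDet_smul_left, ← hvu, hv]
  have hone : planeDet v u' = 1 := by
    rcases Int.eq_one_or_neg_one_of_mul_eq_one hunit with h | h <;> omega
  rw [hvu, hone, one_smul]

/-- The inclusion of the lattice `ℤ^d` into `ℝ^d`. -/
def latticeEmb {d : ℕ} : (Fin d → ℤ) →+ (Fin d → ℝ) :=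
  (Int.castAddHom ℝ).compLeft (Fin d)

section LatticeEmb

variable {d : ℕ}

@[simp]
lemma latticeEmb_apply (z : Fin d → ℤ) (i : Fin d) : latticeEmb z i = z i := rfl

lemma latticeEmb_injective : Function.Injective (latticeEmb (d := d)) :=
  fun _ _ h => funext fun i => Int.cast_injective (congrFun h i)

lemma intLattice_eq_range (d : ℕ) : intLattice d = Set.range latticeEmb := rfl

lemma latticeEmb_mem_intLattice (z : Fin d → ℤ) : latticeEmb z ∈ intLattice d := ⟨z, rfl⟩

lemma latticeEmb_smul (k : ℤ) (z : Fin d → ℤ) :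
    latticeEmb (k • z) = (k : ℝ) • latticeEmb z := by
  ext i; simp

lemma latticeEmb_dotProduct (u z : Fin d → ℤ) :
    latticeEmb u ⬝ᵥ latticeEmb z = ((u ⬝ᵥ z : ℤ) : ℝ) := by
  simp [dotProduct]

lemma planeDet_latticeEmb (u v : Fin 2 → ℤ) :
    planeDet (latticeEmb u) (latticeEmb v) = ((planeDet u v : ℤ) : ℝ) := by
  simp [planeDet]

lemma isClosedEmbedding_latticeEmb : Topology.IsClosedEmbedding (latticeEmb (d := d)) :=
  Topology.IsClosedEmbedding.piMap fun _ => Int.isClosedEmbedding_coe_real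

end LatticeEmb

/-! ### Smooth fans -/

/-- A complete smooth fan in the plane, encoded by the finite set `U` of the primitive generators
of its rays and the map `s` that sends each of them to the next one in counterclockwise order. -/
structure IsSmoothFan (U : Finset (Fin 2 → ℤ)) (s : (Fin 2 → ℤ) → Fin 2 → ℤ) : Prop where
  mapsTo : ∀ u ∈ U, s u ∈ U
  det_eq : ∀ u ∈ U, planeDet u (s u) = 1
  not_between : ∀ u ∈ U, ∀ v ∈ U, 0 < planeDet u v → ¬ 0 < planeDet v (s u)
  complete : ∀ x, ∃ u ∈ U, 0 ≤ planeDet u x ∧ 0 ≤ planeDet x (s u)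

lemma eq_one_of_lex_lt {a f₁ f₂ f g₁ g₂ g : ℤ} (hf : f₁ + f₂ = a * f) (hg : g₁ + g₂ = a * g)
    (h₁ : toLex (f₁, g₁) < toLex (f, g)) (h₂ : toLex (f₂, g₂) < toLex (f, g))
    (hpos : 0 < f₁ + f₂) : a = 1 := by
  rw [Prod.Lex.toLex_lt_toLex] at h₁ h₂
  have hf₁ : f₁ ≤ f := h₁.elim le_of_lt fun h => h.1.le
  have hf₂ : f₂ ≤ f := h₂.elim le_of_lt fun h => h.1.le
  have ha : 0 < a := by by_contra! h; nlinarith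
  have ha' : a ≤ 2 := by by_contra! h; nlinarith
  have hne : a ≠ 2 := by rintro rfl; omega
  omega

namespace IsSmoothFan

variable {U : Finset (Fin 2 → ℤ)} {s : (Fin 2 → ℤ) → Fin 2 → ℤ} {p u v : Fin 2 → ℤ}

lemma det_succ (hU : IsSmoothFan U s) (hu : u ∈ U) : planeDet (s u) (s (s u)) = 1 :=
  hU.det_eq _ (hU.mapsTo u hu)

lemma injOn (hU : IsSmoothFan U s) : Set.InjOn s U := by
  have det_nonpos : ∀ u ∈ U, ∀ v ∈ U, s u = s v → planeDet u v ≤ 0 := by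
    intro u hu v hv h
    by_contra! hpos
    refine hU.not_between u hu v hv hpos ?_
    rw [h, hU.det_eq v hv]; exact one_pos
  intro u hu v hv h
  have huv := det_nonpos u hu v hv h
  have hvu := det_nonpos v hv u hu h.symm
  rw [planeDet_swap] at hvu
  exact (eq_of_planeDet_eq_zero (hU.det_eq u hu) (hU.det_eq v hv) (by omega)
    (by rw [h, hU.det_eq v hv]; exact one_pos)).symm

lemma exists_succ_eq (hU : IsSmoothFan U s) (hv : v ∈ U) : ∃ u ∈ U, s u = v :=
  Finset.surjOn_of_injOn_of_card_le s hU.mapsTo hU.injOn le_rfl hv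

lemma succ_ne (hU : IsSmoothFan U s) (hu : u ∈ U) : s u ≠ u := by
  intro h
  have := hU.det_eq u hu
  rw [h, planeDet_self] at this; omega

lemma succ_succ_ne (hU : IsSmoothFan U s) (hu : u ∈ U) : s (s u) ≠ u := by
  intro h
  have h₁ := hU.det_eq u hu
  have h₂ := hU.det_succ hu
  rw [h, planeDet_swap] at h₂; omega

lemma add_succ_succ (hU : IsSmoothFan U s) (hu : u ∈ U) :
    u + s (s u) = planeDet u (s (s u)) • s u :=
  add_eq_planeDet_smul (hU.det_eq u hu) (hU.det_succ hu)

lemma eq_or_eq_succ (hU : IsSmoothFan U s) (hu : u ∈ U) (hv : v ∈ U)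
    (h₁ : 0 ≤ planeDet u v) (h₂ : 0 ≤ planeDet v (s u)) : v = u ∨ v = s u := by
  have hus := hU.det_eq u hu
  have hvs := hU.det_eq v hv
  have hne : ¬ (planeDet u v = 0 ∧ planeDet v (s u) = 0) := by
    rintro ⟨h₃, h₄⟩
    have hv0 := eq_planeDet_smul_add hus v
    rw [h₃, h₄, zero_smul, zero_smul, add_zero] at hv0
    rw [hv0] at hvs
    simp [planeDet] at hvs
  have hnot := hU.not_between u hu v hv
  rcases h₁.eq_or_lt with h | h
  · exact .inl <| eq_of_planeDet_eq_zero hus hvs h.symm (by omega)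
  · have h₀ : planeDet v (s u) = 0 := by omega
    refine .inr <| eq_of_planeDet_eq_zero (u' := -u) (v' := s v) ?_ hvs ?_ ?_
    · rw [planeDet_neg_right, planeDet_swap]; omega
    · rw [planeDet_swap]; omega
    · rw [planeDet_neg_right, planeDet_swap]; omega

lemma nonempty (hU : IsSmoothFan U s) : U.Nonempty :=
  let ⟨u, hu, _⟩ := hU.complete 0
  ⟨u, hu⟩

lemma card_triple (hU : IsSmoothFan U s) (hu : u ∈ U) :
    ({u, s u, s (s u)} : Finset (Fin 2 → ℤ)).card = 3 :=
  Finset.card_eq_three.2 ⟨u, s u, s (s u), (hU.succ_ne hu).symm, (hU.succ_succ_ne hu).symm,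
    (hU.succ_ne (hU.mapsTo u hu)).symm, rfl⟩

lemma triple_subset (hU : IsSmoothFan U s) (hu : u ∈ U) :
    ({u, s u, s (s u)} : Finset (Fin 2 → ℤ)) ⊆ U := by
  have hsu := hU.mapsTo u hu
  simp only [Finset.insert_subset_iff, Finset.singleton_subset_iff]
  exact ⟨hu, hsu, hU.mapsTo _ hsu⟩

lemma three_le_card (hU : IsSmoothFan U s) : 3 ≤ U.card := by
  obtain ⟨u, hu⟩ := hU.nonempty
  rw [← hU.card_triple hu]
  exact Finset.card_le_card (hU.triple_subset hu)

-- A longest generator has neighbours no longer than itself: apply the parallelogram law to them.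
lemma exists_abs_planeDet_le_one (hU : IsSmoothFan U s) :
    ∃ p ∈ U, |planeDet p (s (s p))| ≤ 1 := by
  obtain ⟨p, hp, hmax⟩ := U.exists_max_image (fun p => s p ⬝ᵥ s p) hU.nonempty
  have hle : ∀ v ∈ U, v ⬝ᵥ v ≤ s p ⬝ᵥ s p := by
    intro v hv
    obtain ⟨u, hu, rfl⟩ := hU.exists_succ_eq hv
    exact hmax u hu
  refine ⟨p, hp, ?_⟩
  have hp_le := hle p hp
  have hq_le := hle _ (hU.mapsTo _ (hU.mapsTo p hp))
  have hsum := hU.add_succ_succ hp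
  have hdiff : 0 < (p - s (s p)) ⬝ᵥ (p - s (s p)) := by
    refine lt_of_le_of_ne (Finset.sum_nonneg fun i _ => mul_self_nonneg _) fun h => ?_
    exact hU.succ_succ_ne hp (sub_eq_zero.1 (dotProduct_self_eq_zero.1 h.symm)).symm
  generalize planeDet p (s (s p)) = a at hsum ⊢
  have parallelogram : a ^ 2 * (s p ⬝ᵥ s p) + (p - s (s p)) ⬝ᵥ (p - s (s p)) =
      2 * (p ⬝ᵥ p) + 2 * (s (s p) ⬝ᵥ s (s p)) := by
    have hsq := congrArg (fun v => v ⬝ᵥ v) hsum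
    simp only [add_dotProduct, dotProduct_add, smul_dotProduct, dotProduct_smul, smul_eq_mul] at hsq
    simp only [sub_dotProduct, dotProduct_sub]
    linear_combination -hsq
  have hm : 0 ≤ s p ⬝ᵥ s p := Finset.sum_nonneg fun i _ => mul_self_nonneg _
  have ha : a ^ 2 < 2 ^ 2 := by
    by_contra! h
    linarith [mul_le_mul_of_nonneg_right h hm]
  have := abs_lt_of_sq_lt_sq ha two_pos.le
  omega

lemma planeDet_pos_of_notMem_triple (hU : IsSmoothFan U s) (hp : p ∈ U)
    (ha : planeDet p (s (s p)) ≤ 0) {x : Fin 2 → ℤ} (hx : x ∈ U \ {p, s p, s (s p)}) :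
    0 < planeDet (s (s p)) x ∧ 0 < planeDet x p := by
  simp only [Finset.mem_sdiff, Finset.mem_insert, Finset.mem_singleton, not_or] at hx
  obtain ⟨hxU, hxp, hxm, hxq⟩ := hx
  have not_first : ¬ (0 ≤ planeDet p x ∧ 0 ≤ planeDet x (s p)) := fun h =>
    (hU.eq_or_eq_succ hp hxU h.1 h.2).elim hxp hxm
  have not_second : ¬ (0 ≤ planeDet (s p) x ∧ 0 ≤ planeDet x (s (s p))) := fun h =>
    (hU.eq_or_eq_succ (hU.mapsTo p hp) hxU h.1 h.2).elim hxm hxq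
  have hsum := congrArg (planeDet x) (hU.add_succ_succ hp)
  rw [planeDet_add_right, planeDet_smul_right] at hsum
  rw [planeDet_swap x p, planeDet_swap x (s p)] at *
  rw [planeDet_swap x (s (s p))]
  rcases le_or_gt 0 (planeDet x (s p)) with h | h
  · have := mul_nonpos_of_nonpos_of_nonneg ha h
    omega
  · have := mul_nonneg_of_nonpos_of_nonpos ha h.le
    omega

lemma card_le_four_of_succ_eq (hU : IsSmoothFan U s) (hp : p ∈ U)
    (ha : planeDet p (s (s p)) ≤ 0) (h : s (s (s (s p))) = p) : U.card ≤ 4 := by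
  have hq := hU.mapsTo _ (hU.mapsTo p hp)
  have hsub : U ⊆ {s (s (s p)), p, s p, s (s p)} := by
    intro x hx
    by_cases hmem : x ∈ ({p, s p, s (s p)} : Finset (Fin 2 → ℤ))
    · exact Finset.mem_insert_of_mem hmem
    obtain ⟨hqx, hxp⟩ := hU.planeDet_pos_of_notMem_triple hp ha (Finset.mem_sdiff.2 ⟨hx, hmem⟩)
    rcases le_or_gt 0 (planeDet x (s (s (s p)))) with hle | hlt
    · rcases hU.eq_or_eq_succ hq hx hqx.le hle with rfl | rfl <;> simp
    · rw [planeDet_swap] at hlt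
      rcases hU.eq_or_eq_succ (hU.mapsTo _ hq) hx (by omega) (by rw [h]; exact hxp.le) with
        rfl | rfl
      · simp
      · simp [h]
  refine (Finset.card_le_card hsub).trans ((Finset.card_insert_le _ _).trans ?_)
  rw [hU.card_triple hp]

lemma two_le_planeDet_sub_of_notMem_triple (hU : IsSmoothFan U s) (hp : p ∈ U)
    (ha : planeDet p (s (s p)) ≤ 0) {x : Fin 2 → ℤ} (hx : x ∈ U \ {p, s p, s (s p)}) :
    2 ≤ planeDet (s (s p) - p) x := by
  have := hU.planeDet_pos_of_notMem_triple hp ha hx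
  rw [planeDet_sub_left, planeDet_swap x p]; omega

lemma planeDet_sub_eq_or_two_le (hU : IsSmoothFan U s) (hp : p ∈ U)
    (ha : planeDet p (s (s p)) ≤ 0) {x : Fin 2 → ℤ} (hx : x ∈ U) (hxs : x ≠ s p) :
    (x = p ∨ x = s (s p)) ∧ planeDet (s (s p) - p) x = -planeDet p (s (s p)) ∨
      x ∈ U \ {p, s p, s (s p)} ∧ 2 ≤ planeDet (s (s p) - p) x := by
  by_cases h : x = p ∨ x = s (s p)
  · refine .inl ⟨h, ?_⟩
    rw [planeDet_sub_left]
    rcases h with rfl | rfl <;> rw [planeDet_self]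
    · rw [sub_zero, planeDet_swap]
    · rw [zero_sub]
  · have hxV : x ∈ U \ {p, s p, s (s p)} := by
      simp only [Finset.mem_sdiff, Finset.mem_insert, Finset.mem_singleton]
      tauto
    exact .inr ⟨hxV, hU.two_le_planeDet_sub_of_notMem_triple hp ha hxV⟩

-- The point highest above the line through `p` and `s (s p)`, ties being broken by the height
-- along that line.
lemma exists_lex_max (hU : IsSmoothFan U s) (hcard : 4 ≤ U.card) (hp : p ∈ U)
    (ha : planeDet p (s (s p)) ≤ 0) (ha' : -1 ≤ planeDet p (s (s p))) :
    ∃ m ∈ U \ {p, s p, s (s p)}, ∀ x ∈ U, x ≠ s p → x ≠ m →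
      toLex (planeDet (s (s p) - p) x, planeDet (s p) x) <
        toLex (planeDet (s (s p) - p) m, planeDet (s p) m) := by
  have hne : (U \ {p, s p, s (s p)}).Nonempty := by
    refine Finset.sdiff_nonempty.2 fun h => ?_
    have := Finset.card_le_card h
    rw [hU.card_triple hp] at this; omega
  have hdet : planeDet (s (s p) - p) (s p) ≠ 0 := by
    rw [planeDet_sub_left, planeDet_swap (s p), hU.det_eq p hp, hU.det_succ hp]; norm_num
  obtain ⟨m, hm, hmax⟩ := Finset.exists_max_image _
    (fun x => toLex (planeDet (s (s p) - p) x, planeDet (s p) x)) hne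
  refine ⟨m, hm, fun x hx hxs hxm => ?_⟩
  rcases hU.planeDet_sub_eq_or_two_le hp ha hx hxs with ⟨-, hfx⟩ | ⟨hxV, -⟩
  · have := hU.two_le_planeDet_sub_of_notMem_triple hp ha hm
    exact Prod.Lex.toLex_lt_toLex.2 (.inl (by dsimp only; omega))
  · refine lt_of_le_of_ne (hmax x hxV) fun h => hxm ?_
    obtain ⟨h₁, h₂⟩ := Prod.mk.inj (toLex.injective h)
    refine sub_eq_zero.1 (eq_zero_of_planeDet_eq_zero hdet ?_ ?_) <;> rw [planeDet_sub_right]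
    exacts [sub_eq_zero.2 h₁, sub_eq_zero.2 h₂]

lemma exists_blowdown_of_planeDet_nonpos (hU : IsSmoothFan U s) (hcard : 5 ≤ U.card) (hp : p ∈ U)
    (ha : planeDet p (s (s p)) ≤ 0) (ha' : -1 ≤ planeDet p (s (s p))) :
    ∃ u ∈ U, u + s (s u) = s u := by
  obtain ⟨m, hm, hmax⟩ := hU.exists_lex_max (by omega) hp ha ha'
  simp only [Finset.mem_sdiff, Finset.mem_insert, Finset.mem_singleton, not_or] at hm
  obtain ⟨hmU, hmp, hms, hmq⟩ := hm
  obtain ⟨u, hu, rfl⟩ := hU.exists_succ_eq hmU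
  refine ⟨u, hu, ?_⟩
  have hq := hU.mapsTo _ hmU
  have hup : u ≠ s p := by rintro rfl; exact hmq rfl
  have hqp : s (s u) ≠ s p := fun h => hmp (hU.injOn hmU hp h)
  have hsum := hU.add_succ_succ hu
  have sum_eq : ∀ w, planeDet w u + planeDet w (s (s u)) =
      planeDet u (s (s u)) * planeDet w (s u) := fun w => by
    rw [← planeDet_add_right, hsum, planeDet_smul_right]
  by_cases hpos : 0 < planeDet (s (s p) - p) u + planeDet (s (s p) - p) (s (s u))
  · have hone : planeDet u (s (s u)) = 1 := eq_one_of_lex_lt (sum_eq _) (sum_eq _)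
      (hmax u hu hup (hU.succ_ne hu).symm) (hmax _ hq hqp (hU.succ_ne hmU)) hpos
    rw [hsum, hone, one_smul]
  exfalso
  have hcases_u := hU.planeDet_sub_eq_or_two_le hp ha hu hup
  have hcases_q := hU.planeDet_sub_eq_or_two_le hp ha hq hqp
  have hu_eq : u = s (s p) := by
    rcases hcases_u with ⟨h, -⟩ | ⟨-, h⟩
    · exact h.resolve_left fun h => hms (by rw [h])
    · omega
  have hq_eq : s (s u) = p := by
    rcases hcases_q with ⟨h, -⟩ | ⟨-, h⟩
    · exact h.resolve_right fun h => hU.succ_succ_ne hu (h.trans hu_eq.symm)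
    · omega
  have := hU.card_le_four_of_succ_eq hp ha (hu_eq ▸ hq_eq)
  omega

lemma exists_blowdown (hU : IsSmoothFan U s) (hcard : 5 ≤ U.card) :
    ∃ u ∈ U, u + s (s u) = s u := by
  obtain ⟨p, hp, habs⟩ := hU.exists_abs_planeDet_le_one
  rw [abs_le] at habs
  by_cases ha : planeDet p (s (s p)) ≤ 0
  · exact hU.exists_blowdown_of_planeDet_nonpos hcard hp ha habs.1
  · have hone : planeDet p (s (s p)) = 1 := by omega
    exact ⟨p, hp, by rw [hU.add_succ_succ hp, hone, one_smul]⟩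

end IsSmoothFan

/-! ### Unimodular boxes and triangles -/

/-- The linear automorphism of `ℝ^d` with the integral unimodular matrix `A`. -/
noncomputable def unimodularMap {d : ℕ} (A : Matrix.SpecialLinearGroup (Fin d) ℤ) :
    (Fin d → ℝ) ≃ₗ[ℝ] Fin d → ℝ :=
  Matrix.SpecialLinearGroup.toLin' (A.map (Int.castRingHom ℝ))

/-- The lattice parallelepiped with lower corner `c` and side lengths `ℓ` in the lattice
coordinates given by the rows of `A`. -/
def latticeBox {d : ℕ} (A : Matrix.SpecialLinearGroup (Fin d) ℤ) (c ℓ : Fin d → ℤ) :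
    Set (Fin d → ℝ) :=
  unimodularMap A ⁻¹' Set.Icc (latticeEmb c) (latticeEmb (c + ℓ))

/-- The isosceles right triangle with right-angled corner `c`, legs of length `L` and the
directions of the coordinate axes. -/
def cornerTriangle (c : Fin 2 → ℝ) (L : ℝ) : Set (Fin 2 → ℝ) :=
  {y | c 0 ≤ y 0 ∧ c 1 ≤ y 1 ∧ y 0 + y 1 ≤ c 0 + c 1 + L}

section UnimodularMap

variable {d : ℕ} (A : Matrix.SpecialLinearGroup (Fin d) ℤ)

lemma unimodularMap_apply (x : Fin d → ℝ) (i : Fin d) :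
    unimodularMap A x i = latticeEmb (A i) ⬝ᵥ x := rfl

lemma unimodularMap_latticeEmb (z : Fin d → ℤ) :
    unimodularMap A (latticeEmb z) = latticeEmb (A.1.mulVec z) :=
  funext fun i => by rw [unimodularMap_apply, latticeEmb_dotProduct]; rfl

lemma unimodularMap_mem_intLattice_iff {x : Fin d → ℝ} :
    unimodularMap A x ∈ intLattice d ↔ x ∈ intLattice d := by
  refine ⟨fun ⟨z, hz⟩ => ?_, fun ⟨z, hz⟩ => ?_⟩
  · have hinv : unimodularMap A (unimodularMap A⁻¹ (latticeEmb z)) = latticeEmb z := by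
      rw [unimodularMap_latticeEmb, unimodularMap_latticeEmb, Matrix.mulVec_mulVec,
        ← Matrix.SpecialLinearGroup.coe_mul, mul_inv_cancel, Matrix.SpecialLinearGroup.coe_one,
        Matrix.one_mulVec]
    rw [← (unimodularMap A).injective (hinv.trans hz), unimodularMap_latticeEmb]
    exact latticeEmb_mem_intLattice _
  · rw [← hz]
    exact unimodularMap_latticeEmb A z ▸ latticeEmb_mem_intLattice _

lemma volume_preimage_unimodularMap (s : Set (Fin d → ℝ)) :
    volume (unimodularMap A ⁻¹' s) = volume s := by
  have hdet : LinearMap.det (unimodularMap A : (Fin d → ℝ) →ₗ[ℝ] Fin d → ℝ) = 1 := by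
    rw [unimodularMap, Matrix.SpecialLinearGroup.toLin'_to_linearMap, LinearMap.det_toLin',
      Matrix.SpecialLinearGroup.det_coe]
  have hpre := Measure.addHaar_preimage_linearMap (volume : Measure (Fin d → ℝ))
    (hdet ▸ one_ne_zero) s
  simpa [hdet] using hpre

lemma mem_latticeBox_iff {c ℓ : Fin d → ℤ} {x : Fin d → ℝ} :
    x ∈ latticeBox A c ℓ ↔
      ∀ i, (c i : ℝ) ≤ latticeEmb (A i) ⬝ᵥ x ∧ latticeEmb (A i) ⬝ᵥ x ≤ c i + ℓ i := by
  simp [latticeBox, Pi.le_def, unimodularMap_apply, forall_and]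

lemma latticeBox_mono (c : Fin d → ℤ) {ℓ ℓ' : Fin d → ℤ} (h : ℓ ≤ ℓ') :
    latticeBox A c ℓ ⊆ latticeBox A c ℓ' := by
  intro x hx
  rw [mem_latticeBox_iff] at hx ⊢
  refine fun i => ⟨(hx i).1, (hx i).2.trans ?_⟩
  have : (ℓ i : ℝ) ≤ ℓ' i := by exact_mod_cast h i
  linarith

lemma volume_latticeBox (c ℓ : Fin d → ℤ) :
    volume (latticeBox A c ℓ) = ∏ i, ENNReal.ofReal (ℓ i) := by
  rw [latticeBox, volume_preimage_unimodularMap, Real.volume_Icc_pi]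
  simp

end UnimodularMap

lemma preimage_cornerTriangle_subset_latticeBox (A : Matrix.SpecialLinearGroup (Fin 2) ℤ)
    (c : Fin 2 → ℤ) (L : ℤ) :
    unimodularMap A ⁻¹' cornerTriangle (latticeEmb c) L ⊆ latticeBox A c fun _ => L := by
  rintro x ⟨h₀, h₁, hsum⟩
  simp only [latticeEmb_apply, unimodularMap_apply] at h₀ h₁ hsum
  exact (mem_latticeBox_iff A).2 <|
    Fin.forall_fin_two.2 ⟨⟨h₀, by linarith⟩, h₁, by linarith⟩

lemma lintegral_Icc_ofReal_sub (c : ℝ) {L : ℝ} (hL : 0 ≤ L) :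
    ∫⁻ x in Set.Icc c (c + L), ENNReal.ofReal (c + L - x) = ENNReal.ofReal (L ^ 2 / 2) := by
  rw [← ofReal_integral_eq_lintegral_ofReal]
  · rw [integral_Icc_eq_integral_Ioc, ← intervalIntegral.integral_of_le (by linarith),
      intervalIntegral.integral_sub (by simp) (by simp)]
    simp only [intervalIntegral.integral_const, integral_id, smul_eq_mul]
    ring_nf
  · exact (by fun_prop : Continuous fun x : ℝ => c + L - x).integrableOn_Icc
  · exact (ae_restrict_iff' measurableSet_Icc).2 <| .of_forall fun x hx => sub_nonneg.2 hx.2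

lemma volume_cornerTriangle (c : Fin 2 → ℝ) {L : ℝ} (hL : 0 ≤ L) :
    volume (cornerTriangle c L) = ENNReal.ofReal (L ^ 2 / 2) := by
  set T := {p : ℝ × ℝ | c 0 ≤ p.1 ∧ c 1 ≤ p.2 ∧ p.1 + p.2 ≤ c 0 + c 1 + L}
  have hT : MeasurableSet T :=
    ((isClosed_le continuous_const continuous_fst).inter
      ((isClosed_le continuous_const continuous_snd).inter
        (isClosed_le (continuous_fst.add continuous_snd) continuous_const))).measurableSet
  have hpre : cornerTriangle c L = MeasurableEquiv.finTwoArrow ⁻¹' T := by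
    ext x; simp [T, cornerTriangle, MeasurableEquiv.finTwoArrow]
  have slice : ∀ x, volume (Prod.mk x ⁻¹' T) =
      (Set.Icc (c 0) (c 0 + L)).indicator (fun x => ENNReal.ofReal (c 0 + L - x)) x := by
    intro x
    by_cases hx : x ∈ Set.Icc (c 0) (c 0 + L)
    · have : Prod.mk x ⁻¹' T = Set.Icc (c 1) (c 0 + c 1 + L - x) := by
        ext y
        exact ⟨fun hy => ⟨hy.2.1, le_sub_iff_add_le'.2 hy.2.2⟩,
          fun hy => ⟨hx.1, hy.1, le_sub_iff_add_le'.1 hy.2⟩⟩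
      rw [this, Set.indicator_of_mem hx, Real.volume_Icc]
      ring_nf
    · have : Prod.mk x ⁻¹' T = ∅ := by
        refine Set.eq_empty_of_forall_notMem fun y ⟨h₁, h₂, h₃⟩ => hx ⟨h₁, ?_⟩
        dsimp only at h₂ h₃
        linarith
      rw [this, Set.indicator_of_notMem hx, measure_empty]
  rw [hpre, (volume_preserving_finTwoArrow ℝ).measure_preimage hT.nullMeasurableSet,
    Measure.volume_eq_prod, Measure.prod_apply hT, lintegral_congr slice,
    lintegral_indicator measurableSet_Icc, lintegral_Icc_ofReal_sub _ hL]

/-! ### Polygons with given support numbers -/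

/-- The matrix with rows `r` and `t`. -/
def rowMatrix (r t : Fin 2 → ℤ) (h : planeDet r t = 1) : Matrix.SpecialLinearGroup (Fin 2) ℤ :=
  ⟨Matrix.of ![r, t], by rw [Matrix.det_fin_two, ← h, planeDet]; simp [mul_comm]⟩

/-- The polyhedron with inner normals in `U` and support numbers `h`. -/
def supportRegion {d : ℕ} (U : Finset (Fin d → ℤ)) (h : (Fin d → ℤ) → ℤ) : Set (Fin d → ℝ) :=
  {x | ∀ u ∈ U, (h u : ℝ) ≤ latticeEmb u ⬝ᵥ x}

/-- The lattice length, in terms of the support numbers `h`, of the edge whose inner normal is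
`s u`. -/
def edgeLen (s : (Fin 2 → ℤ) → Fin 2 → ℤ) (h : (Fin 2 → ℤ) → ℤ) (u : Fin 2 → ℤ) : ℤ :=
  planeDet u (s (s u)) * h (s u) - h u - h (s (s u))

/-- The successor map of the fan obtained by removing the ray of `s p`. -/
def contract (s : (Fin 2 → ℤ) → Fin 2 → ℤ) (p : Fin 2 → ℤ) : (Fin 2 → ℤ) → Fin 2 → ℤ :=
  Function.update s p (s (s p))

lemma supportRegion_anti {d : ℕ} {U V : Finset (Fin d → ℤ)} (hUV : U ⊆ V)
    (h : (Fin d → ℤ) → ℤ) : supportRegion V h ⊆ supportRegion U h :=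
  fun _ hx u hu => hx u (hUV hu)

lemma contract_self (s : (Fin 2 → ℤ) → Fin 2 → ℤ) (p : Fin 2 → ℤ) :
    contract s p p = s (s p) :=
  Function.update_self ..

lemma contract_of_ne (s : (Fin 2 → ℤ) → Fin 2 → ℤ) {p u : Fin 2 → ℤ} (h : u ≠ p) :
    contract s p u = s u :=
  Function.update_of_ne h ..

namespace IsSmoothFan

variable {U : Finset (Fin 2 → ℤ)} {s : (Fin 2 → ℤ) → Fin 2 → ℤ} {h : (Fin 2 → ℤ) → ℤ}
  {p r u v : Fin 2 → ℤ}

lemma planeDet_succ_succ_of_add_eq (hU : IsSmoothFan U s) (hp : p ∈ U)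
    (hsum : p + s (s p) = s p) : planeDet p (s (s p)) = 1 := by
  have h := congrArg (planeDet p) hsum
  rwa [planeDet_add_right, planeDet_self, zero_add, hU.det_eq p hp] at h

lemma eq_succ_of_between (hU : IsSmoothFan U s) (hp : p ∈ U) (hv : v ∈ U)
    (h₁ : 0 < planeDet p v) (h₂ : 0 < planeDet v (s (s p))) : v = s p := by
  rcases le_total 0 (planeDet v (s p)) with h | h
  · refine (hU.eq_or_eq_succ hp hv h₁.le h).resolve_left ?_
    rintro rfl
    exact h₁.ne' (planeDet_self v)
  · refine (hU.eq_or_eq_succ (hU.mapsTo p hp) hv ?_ h₂.le).resolve_right ?_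
    · rw [planeDet_swap]; omega
    · rintro rfl
      exact h₂.ne' (planeDet_self _)

lemma exists_cone_contract (hU : IsSmoothFan U s) (hp : p ∈ U) (hsum : p + s (s p) = s p)
    (x : Fin 2 → ℤ) :
    ∃ u ∈ U.erase (s p), 0 ≤ planeDet u x ∧ 0 ≤ planeDet x (contract s p u) := by
  have hpmem : p ∈ U.erase (s p) := Finset.mem_erase.2 ⟨(hU.succ_ne hp).symm, hp⟩
  have hx := congrArg (planeDet x) hsum
  rw [planeDet_add_right] at hx
  obtain ⟨u, hu, h₁, h₂⟩ := hU.complete x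
  rcases eq_or_ne u p with rfl | hup
  · refine ⟨u, hpmem, h₁, ?_⟩
    rw [planeDet_swap] at h₁
    rw [contract_self]; omega
  rcases eq_or_ne u (s p) with rfl | hus
  · refine ⟨p, hpmem, ?_, by rwa [contract_self]⟩
    rw [planeDet_swap] at h₁ ⊢; omega
  · exact ⟨u, Finset.mem_erase.2 ⟨hus, hu⟩, h₁, by rwa [contract_of_ne s hup]⟩

protected lemma contract (hU : IsSmoothFan U s) (hp : p ∈ U) (hsum : p + s (s p) = s p) :
    IsSmoothFan (U.erase (s p)) (contract s p) where
  mapsTo u hu := by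
    replace hu := Finset.mem_of_mem_erase hu
    rcases eq_or_ne u p with rfl | hup
    · have hsu := hU.mapsTo u hu
      exact contract_self s u ▸ Finset.mem_erase.2 ⟨hU.succ_ne hsu, hU.mapsTo _ hsu⟩
    · exact contract_of_ne s hup ▸
        Finset.mem_erase.2 ⟨fun h => hup (hU.injOn hu hp h), hU.mapsTo u hu⟩
  det_eq u hu := by
    rcases eq_or_ne u p with rfl | hup
    · rw [contract_self, hU.planeDet_succ_succ_of_add_eq hp hsum]
    · rw [contract_of_ne s hup, hU.det_eq u (Finset.mem_of_mem_erase hu)]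
  not_between u hu v hv h₁ h₂ := by
    obtain ⟨hvs, hvU⟩ := Finset.mem_erase.1 hv
    rcases eq_or_ne u p with rfl | hup
    · exact hvs (hU.eq_succ_of_between hp hvU h₁ (contract_self s u ▸ h₂))
    · exact hU.not_between u (Finset.mem_of_mem_erase hu) v hvU h₁ (contract_of_ne s hup ▸ h₂)
  complete := hU.exists_cone_contract hp hsum

lemma edgeLen_contract_of_ne (h : (Fin 2 → ℤ) → ℤ) (hup : u ≠ p) (hsup : s u ≠ p) :
    edgeLen (contract s p) h u = edgeLen s h u := by
  simp only [edgeLen, contract_of_ne s hup, contract_of_ne s hsup]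

lemma edgeLen_contract_self (hU : IsSmoothFan U s) (hp : p ∈ U) (hsum : p + s (s p) = s p)
    (h : (Fin 2 → ℤ) → ℤ) :
    edgeLen (contract s p) h p = edgeLen s h (s p) + edgeLen s h p := by
  have hdet : planeDet (s p) (s (s (s p))) = planeDet p (s (s (s p))) + 1 := by
    rw [← hU.det_succ (hU.mapsTo p hp), ← planeDet_add_left, hsum]
  simp only [edgeLen, contract_self, contract_of_ne s (hU.succ_succ_ne hp),
    hU.planeDet_succ_succ_of_add_eq hp hsum, hdet]
  ring

lemma edgeLen_contract_pred (hU : IsSmoothFan U s) (hu : u ∈ U)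
    (hsum : s u + s (s (s u)) = s (s u)) (h : (Fin 2 → ℤ) → ℤ) :
    edgeLen (contract s (s u)) h u = edgeLen s h u + edgeLen s h (s u) := by
  have hdet : planeDet u (s (s u)) = 1 + planeDet u (s (s (s u))) := by
    rw [← hU.det_eq u hu, ← planeDet_add_right, hsum]
  simp only [edgeLen, contract_self, contract_of_ne s (hU.succ_ne hu).symm,
    hU.planeDet_succ_succ_of_add_eq (hU.mapsTo u hu) hsum, hdet]
  ring

lemma edgeLen_contract_bounds (hU : IsSmoothFan U s) (hp : p ∈ U) (hsum : p + s (s p) = s p)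
    {b : ℤ} (hlen : ∀ u ∈ U, 1 ≤ edgeLen s h u ∧ edgeLen s h u ≤ b) :
    ∀ u ∈ U.erase (s p),
      1 ≤ edgeLen (contract s p) h u ∧ edgeLen (contract s p) h u ≤ 2 * b := by
  intro u hu
  replace hu := Finset.mem_of_mem_erase hu
  have hlen_p := hlen p hp
  have hlen_u := hlen u hu
  rcases eq_or_ne u p with rfl | hup
  · have hlen_s := hlen _ (hU.mapsTo u hp)
    rw [hU.edgeLen_contract_self hp hsum]; omega
  rcases eq_or_ne (s u) p with rfl | hsup
  · rw [hU.edgeLen_contract_pred hu hsum]; omega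
  · rw [edgeLen_contract_of_ne h hup hsup]; omega

lemma neg_ne_self (hU : IsSmoothFan U s) (hr : r ∈ U) : -r ≠ r := by
  intro h
  have h₁ := hU.det_eq r hr
  have h₂ := planeDet_neg_left r (s r)
  rw [h] at h₂; omega

lemma succ_ne_neg (hU : IsSmoothFan U s) (hr : r ∈ U) : s r ≠ -r := by
  intro h
  have hr := hU.det_eq r hr
  rw [h, planeDet_neg_right, planeDet_self] at hr; omega

-- The contraction changes only the edges of `p` and of its predecessor, which are not opposite.
lemma edgeLen_contract_opposite_le (hU : IsSmoothFan U s) {b : ℤ}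
    (hlen : ∀ u ∈ U, edgeLen s h u ≤ b) (hr : r ∈ U) (hr' : -r ∈ U) :
    edgeLen (contract s p) h r ≤ b ∨ edgeLen (contract s p) h (-r) ≤ b := by
  by_cases hrp : r ≠ p ∧ s r ≠ p
  · exact .inl (edgeLen_contract_of_ne h hrp.1 hrp.2 ▸ hlen r hr)
  refine .inr ?_
  rw [edgeLen_contract_of_ne h ?_ ?_]
  · exact hlen _ hr'
  · rintro rfl
    rcases not_and_or.1 hrp with h | h <;> rw [not_not] at h
    · exact hU.neg_ne_self hr h.symm
    · exact hU.succ_ne_neg hr h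
  · rintro rfl
    rcases not_and_or.1 hrp with h | h <;> rw [not_not] at h
    · exact hU.succ_ne_neg hr' (by rw [neg_neg, ← h])
    · exact hU.neg_ne_self hr (hU.injOn hr hr' h).symm

lemma eq_triple_of_card_eq_three (hU : IsSmoothFan U s) (hcard : U.card = 3) (hu : u ∈ U) :
    {u, s u, s (s u)} = U :=
  Finset.eq_of_subset_of_card_le (hU.triple_subset hu) (by rw [hcard, hU.card_triple hu])

lemma succ_succ_succ_eq_of_card_eq_three (hU : IsSmoothFan U s) (hcard : U.card = 3)
    (hu : u ∈ U) : s (s (s u)) = u := by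
  have hm := hU.mapsTo u hu
  have hq := hU.mapsTo _ hm
  have hz := hU.mapsTo _ hq
  rw [← hU.eq_triple_of_card_eq_three hcard hu] at hz
  simp only [Finset.mem_insert, Finset.mem_singleton] at hz
  exact hz.resolve_right fun h => h.elim (hU.succ_succ_ne hm) (hU.succ_ne hq)

-- Otherwise the injective map `s` would fix the fourth generator.
lemma succ_succ_succ_ne_of_card_eq_four (hU : IsSmoothFan U s) (hcard : U.card = 4)
    (hu : u ∈ U) : s (s (s u)) ≠ u := by
  intro hcycle
  have hm := hU.mapsTo u hu
  have hq := hU.mapsTo _ hm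
  have hdiff : (U \ {u, s u, s (s u)}).card = 1 := by
    rw [Finset.card_sdiff_of_subset (hU.triple_subset hu), hU.card_triple hu, hcard]
  obtain ⟨x, hx⟩ := Finset.card_eq_one.1 hdiff
  have hx_mem : x ∈ U \ {u, s u, s (s u)} := hx ▸ Finset.mem_singleton_self x
  simp only [Finset.mem_sdiff, Finset.mem_insert, Finset.mem_singleton, not_or] at hx_mem
  obtain ⟨hxU, hxu, hxm, hxq⟩ := hx_mem
  have hsx : s x ∈ U \ {u, s u, s (s u)} := by
    simp only [Finset.mem_sdiff, Finset.mem_insert, Finset.mem_singleton, not_or]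
    exact ⟨hU.mapsTo x hxU, fun h => hxq (hU.injOn hxU hq (h.trans hcycle.symm)),
      fun h => hxu (hU.injOn hxU hu h), fun h => hxm (hU.injOn hxU hm h)⟩
  rw [hx, Finset.mem_singleton] at hsx
  exact hU.succ_ne hxU hsx

lemma succ_succ_succ_succ_eq_of_card_eq_four (hU : IsSmoothFan U s) (hcard : U.card = 4)
    (hu : u ∈ U) : s (s (s (s u))) = u := by
  have hm := hU.mapsTo u hu
  have hq := hU.mapsTo _ hm
  have hz := hU.mapsTo _ hq
  have hquad : insert (s (s (s u))) {u, s u, s (s u)} = U := by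
    refine Finset.eq_of_subset_of_card_le
      (Finset.insert_subset hz (hU.triple_subset hu)) ?_
    rw [Finset.card_insert_of_notMem, hU.card_triple hu, hcard]
    simp only [Finset.mem_insert, Finset.mem_singleton, not_or]
    exact ⟨hU.succ_succ_succ_ne_of_card_eq_four hcard hu, hU.succ_succ_ne hm, hU.succ_ne hq⟩
  have hw := hU.mapsTo _ hz
  rw [← hquad] at hw
  simp only [Finset.mem_insert, Finset.mem_singleton] at hw
  rcases hw with h | h | h | h
  · exact absurd h (hU.succ_ne hz)
  · exact h
  · exact absurd h (hU.succ_succ_succ_ne_of_card_eq_four hcard hm)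
  · exact absurd h (hU.succ_succ_ne hq)

lemma exists_opposite_of_card_eq_four (hU : IsSmoothFan U s) (hcard : U.card = 4) :
    ∃ r ∈ U, -r ∈ U ∧ s (s r) = -r ∧ s (s (-r)) = r := by
  obtain ⟨u, hu⟩ := hU.nonempty
  have hm := hU.mapsTo u hu
  have hq := hU.mapsTo _ hm
  have hz := hU.mapsTo _ hq
  have hcycle := hU.succ_succ_succ_succ_eq_of_card_eq_four hcard hu
  have hsum := hU.add_succ_succ hu
  have hsum' := hU.add_succ_succ hq
  rw [hcycle, planeDet_swap, add_comm, hsum, neg_smul, ← sub_eq_zero, sub_neg_eq_add,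
    ← smul_add, smul_eq_zero] at hsum'
  rcases hsum' with h | h
  · rw [h, zero_smul] at hsum
    have hneg := eq_neg_of_add_eq_zero_right hsum
    exact ⟨u, hu, hneg ▸ hq, hneg, by rw [← hneg, hcycle]⟩
  · have hneg := eq_neg_of_add_eq_zero_right h
    exact ⟨s u, hm, hneg ▸ hz, hneg, by rw [← hneg, hcycle]⟩

lemma exists_supportRegion_subset_cornerTriangle (hU : IsSmoothFan U s) (hcard : U.card = 3)
    (h : (Fin 2 → ℤ) → ℤ) : ∃ r ∈ U, ∃ A c,
      supportRegion U h ⊆ unimodularMap A ⁻¹' cornerTriangle (latticeEmb c) (edgeLen s h r) := by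
  obtain ⟨u, hu⟩ := hU.nonempty
  have hm := hU.mapsTo u hu
  have hq := hU.mapsTo _ hm
  have hcycle := hU.succ_succ_succ_eq_of_card_eq_three hcard hu
  have hdet : planeDet u (s (s u)) = -1 := by
    rw [planeDet_swap, ← hU.det_eq _ hq, hcycle]
  have hsum : s (s u) = -(u + s u) := by
    have := hU.add_succ_succ hu
    rw [hdet, neg_one_smul] at this
    rw [neg_add, ← this]; abel
  refine ⟨u, hu, rowMatrix u (s u) (hU.det_eq u hu), ![h u, h (s u)], fun x hx => ?_⟩
  refine ⟨hx u hu, hx _ hm, ?_⟩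
  have hx₃ := hx _ hq
  rw [show latticeEmb (s (s u)) = -(latticeEmb u + latticeEmb (s u)) by
    rw [hsum, map_neg, map_add], neg_dotProduct, add_dotProduct] at hx₃
  change latticeEmb u ⬝ᵥ x + latticeEmb (s u) ⬝ᵥ x ≤ h u + h (s u) + (edgeLen s h u : ℤ)
  rw [edgeLen, hdet]
  push_cast
  linarith

lemma dotProduct_succ_le_of_opposite (hU : IsSmoothFan U s) {r : Fin 2 → ℤ} (hr : r ∈ U)
    (hr' : -r ∈ U) (hss : s (s r) = -r) (hss' : s (s (-r)) = r) {B : ℤ}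
    (hlen : ∀ u ∈ U, edgeLen s h u ≤ B) {x : Fin 2 → ℝ} (hx : x ∈ supportRegion U h) :
    latticeEmb (s r) ⬝ᵥ x ≤ h (s r) + B := by
  have ht := hU.mapsTo r hr
  have ht' := hU.mapsTo _ hr'
  have len_t := hlen _ ht
  have len_t' := hlen _ ht'
  have hsum := hU.add_succ_succ ht
  simp only [edgeLen, hss, hss'] at len_t len_t' hsum
  rw [planeDet_swap] at len_t'
  have hx_r := hx r hr
  have hx_neg := hx _ hr'
  have hx_t' := hx _ ht'
  rw [map_neg, neg_dotProduct] at hx_neg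
  generalize planeDet (s r) (s (-r)) = k at *
  have dot_sum : latticeEmb (s r) ⬝ᵥ x + latticeEmb (s (-r)) ⬝ᵥ x =
      -(k * (latticeEmb r ⬝ᵥ x)) := by
    rw [← add_dotProduct, ← map_add, hsum, latticeEmb_smul, map_neg, smul_dotProduct,
      neg_dotProduct, smul_eq_mul, mul_neg]
  have len_t : (k : ℝ) * h (-r) - h (s r) - h (s (-r)) ≤ B := by exact_mod_cast len_t
  have len_t' : -(k : ℝ) * h r - h (s (-r)) - h (s r) ≤ B := by exact_mod_cast len_t'
  rcases le_total 0 (k : ℝ) with hk | hk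
  · linarith [mul_le_mul_of_nonneg_left hx_r hk]
  · linarith [mul_le_mul_of_nonpos_left hx_neg hk]

lemma exists_supportRegion_subset_latticeBox_of_card_eq_four (hU : IsSmoothFan U s)
    (hcard : U.card = 4) {B : ℤ} (hlen : ∀ u ∈ U, edgeLen s h u ≤ B) :
    ∃ r ∈ U, -r ∈ U ∧ edgeLen s h (-r) = edgeLen s h r ∧ ∃ A c,
      supportRegion U h ⊆ latticeBox A c ![edgeLen s h r, B] := by
  obtain ⟨r, hr, hr', hss, hss'⟩ := hU.exists_opposite_of_card_eq_four hcard
  have ht := hU.mapsTo r hr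
  have len_r : edgeLen s h r = -h r - h (-r) := by
    rw [edgeLen, hss, planeDet_neg_right, planeDet_self]; ring
  have len_neg : edgeLen s h (-r) = -h r - h (-r) := by
    rw [edgeLen, hss', planeDet_neg_left, planeDet_self]; ring
  refine ⟨r, hr, hr', len_neg.trans len_r.symm, rowMatrix r (s r) (hU.det_eq r hr),
    ![h r, h (s r)], fun x hx => ?_⟩
  have hx_neg := hx _ hr'
  rw [map_neg, neg_dotProduct] at hx_neg
  refine (mem_latticeBox_iff _).2 (Fin.forall_fin_two.2 ⟨⟨hx r hr, ?_⟩, hx _ ht, ?_⟩)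
  · change latticeEmb r ⬝ᵥ x ≤ h r + (edgeLen s h r : ℤ)
    rw [len_r]
    push_cast; linarith
  · exact hU.dotProduct_succ_le_of_opposite hr hr' hss hss' hlen hx

lemma exists_supportRegion_subset_latticeBox_of_card_eq_five (hU : IsSmoothFan U s)
    (hcard : U.card = 5) {b : ℤ} (hlen : ∀ u ∈ U, 1 ≤ edgeLen s h u ∧ edgeLen s h u ≤ b) :
    ∃ A c, supportRegion U h ⊆ latticeBox A c ![b, 2 * b] := by
  obtain ⟨p, hp, hsum⟩ := hU.exists_blowdown hcard.ge
  have hsp := hU.mapsTo p hp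
  obtain ⟨r, hr, hr', hrr, A, c, hbox⟩ :=
    (hU.contract hp hsum).exists_supportRegion_subset_latticeBox_of_card_eq_four
      (by rw [Finset.card_erase_of_mem hsp, hcard])
      fun u hu => (hU.edgeLen_contract_bounds hp hsum hlen u hu).2
  have hlen_r : edgeLen (contract s p) h r ≤ b := by
    have := hU.edgeLen_contract_opposite_le (p := p) (fun u hu => (hlen u hu).2)
      (Finset.mem_of_mem_erase hr) (Finset.mem_of_mem_erase hr')
    rwa [hrr, or_self] at this
  refine ⟨A, c, ((supportRegion_anti (Finset.erase_subset _ _) h).trans hbox).trans ?_⟩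
  exact latticeBox_mono A c <| Fin.forall_fin_two.2 ⟨hlen_r, le_rfl⟩

lemma exists_supportRegion_subset_latticeBox_of_card_eq_add_five (hU : IsSmoothFan U s) {k : ℕ}
    (hcard : U.card = k + 5) {b : ℤ} (hlen : ∀ u ∈ U, 1 ≤ edgeLen s h u ∧ edgeLen s h u ≤ b) :
    ∃ A c, supportRegion U h ⊆ latticeBox A c ![2 ^ k * b, 2 ^ (k + 1) * b] := by
  induction k generalizing U s b with
  | zero =>
    simpa using hU.exists_supportRegion_subset_latticeBox_of_card_eq_five hcard hlen
  | succ k ih =>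
    obtain ⟨p, hp, hsum⟩ := hU.exists_blowdown (by omega)
    have hsp := hU.mapsTo p hp
    obtain ⟨A, c, hbox⟩ := ih (hU.contract hp hsum)
      (by rw [Finset.card_erase_of_mem hsp, hcard]; omega) (hU.edgeLen_contract_bounds hp hsum hlen)
    refine ⟨A, c, ((supportRegion_anti (Finset.erase_subset _ _) h).trans hbox).trans_eq ?_⟩
    simp only [pow_succ, mul_assoc]

lemma exists_supportRegion_subset_latticeBox (hU : IsSmoothFan U s) {b : ℤ}
    (hlen : ∀ u ∈ U, 1 ≤ edgeLen s h u ∧ edgeLen s h u ≤ b) :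
    ∃ A c, supportRegion U h ⊆ latticeBox A c fun _ => 2 ^ U.card * b := by
  obtain ⟨v, hv⟩ := hU.nonempty
  have hb : 0 ≤ b := by have := hlen v hv; omega
  have le_side : ∀ {j : ℕ}, j ≤ U.card → (2 : ℤ) ^ j * b ≤ 2 ^ U.card * b := fun hj =>
    mul_le_mul_of_nonneg_right (pow_le_pow_right₀ one_le_two hj) hb
  have hb_le : b ≤ 2 ^ U.card * b := by simpa using le_side (Nat.zero_le _)
  have hthree := hU.three_le_card
  obtain hcard | hcard | ⟨k, hcard⟩ : U.card = 3 ∨ U.card = 4 ∨ ∃ k, U.card = k + 5 := by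
    by_cases h : 5 ≤ U.card
    · exact .inr (.inr ⟨U.card - 5, by omega⟩)
    · omega
  · obtain ⟨r, hr, A, c, htri⟩ := hU.exists_supportRegion_subset_cornerTriangle hcard h
    exact ⟨A, c, (htri.trans (preimage_cornerTriangle_subset_latticeBox A c _)).trans <|
      latticeBox_mono A c fun _ => (hlen r hr).2.trans hb_le⟩
  · obtain ⟨r, hr, -, -, A, c, hbox⟩ :=
      hU.exists_supportRegion_subset_latticeBox_of_card_eq_four hcard fun u hu => (hlen u hu).2
    exact ⟨A, c, hbox.trans <| latticeBox_mono A c <|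
      Fin.forall_fin_two.2 ⟨(hlen r hr).2.trans hb_le, hb_le⟩⟩
  · obtain ⟨A, c, hbox⟩ :=
      hU.exists_supportRegion_subset_latticeBox_of_card_eq_add_five hcard hlen
    exact ⟨A, c, hbox.trans <| latticeBox_mono A c <|
      Fin.forall_fin_two.2 ⟨le_side (by omega), le_side (by omega)⟩⟩

end IsSmoothFan

/-! ### Systems of cones -/

/-- A complete system of smooth cones in the plane: the cone with index `v` is spanned by the
lattice basis `a v`, `b v`, and an interior lattice point of one cone lies in no other cone. The
normal cones at the vertices of a smooth polygon form such a system. -/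
structure IsConeSystem {ι : Type*} (V : Finset ι) (a b : ι → Fin 2 → ℤ) : Prop where
  det_eq : ∀ v ∈ V, planeDet (a v) (b v) = 1
  exists_mem : ∀ x, ∃ v ∈ V, 0 ≤ planeDet (a v) x ∧ 0 ≤ planeDet x (b v)
  eq_of_mem : ∀ v ∈ V, ∀ w ∈ V, ∀ x, 0 < planeDet (a v) x → 0 < planeDet x (b v) →
    0 ≤ planeDet (a w) x → 0 ≤ planeDet x (b w) → w = v

namespace IsConeSystem

variable {ι : Type*} {V : Finset ι} {a b : ι → Fin 2 → ℤ} {v w : ι}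

-- Far out near the ray of `a v`, the interior of the cone `v` meets the cone `w` if both start
-- at this ray.
lemma injOn (hV : IsConeSystem V a b) : Set.InjOn a V := by
  intro v hv w hw h
  set x := (|planeDet (b v) (b w)| + 1) • a v + b v
  have hx : planeDet (a v) x = 1 := by
    rw [planeDet_add_right, planeDet_smul_right, planeDet_self, mul_zero, zero_add, hV.det_eq v hv]
  refine (hV.eq_of_mem v hv w hw x (hx ▸ one_pos) ?_ (h ▸ hx ▸ zero_le_one) ?_).symm <;>
    rw [planeDet_add_left, planeDet_smul_left]
  · rw [hV.det_eq v hv, planeDet_self]; positivity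
  · rw [h, hV.det_eq w hw]; linarith [neg_abs_le (planeDet (b v) (b w))]

-- The cone contains `M • y - x` for some large `M`.
lemma exists_mem_beyond (hV : IsConeSystem V a b) (x y : Fin 2 → ℤ) :
    ∃ w ∈ V, 0 ≤ planeDet (a w) y ∧ 0 ≤ planeDet y (b w) ∧
      (planeDet y (b w) = 0 → planeDet x (b w) ≤ 0) := by
  obtain ⟨C, hC⟩ := (V.image fun w => |planeDet (a w) x| + |planeDet x (b w)|).exists_le
  have nonneg_of_large : ∀ {p q : ℤ}, |q| ≤ C → 0 ≤ (C + 1) * p - q → 0 ≤ p ∧ (p = 0 → q ≤ 0) := by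
    intro p q hq hpq
    rw [abs_le] at hq
    refine ⟨?_, fun hp => ?_⟩
    · by_contra! hp; nlinarith
    · rw [hp] at hpq; linarith
  obtain ⟨w, hw, h₁, h₂⟩ := hV.exists_mem ((C + 1) • y - x)
  rw [planeDet_sub_right, planeDet_smul_right] at h₁
  rw [planeDet_sub_left, planeDet_smul_left] at h₂
  have hwC := hC _ (Finset.mem_image_of_mem _ hw)
  exact ⟨w, hw, (nonneg_of_large ((le_add_of_nonneg_right (abs_nonneg _)).trans hwC) h₁).1,
    nonneg_of_large ((le_add_of_nonneg_left (abs_nonneg _)).trans hwC) h₂⟩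

-- The cone that contains the lattice points just beyond the ray of `b v` starts at this ray.
lemma exists_next (hV : IsConeSystem V a b) (hv : v ∈ V) : ∃ w ∈ V, a w = b v := by
  obtain ⟨w, hw, h₁, h₂, h₂'⟩ := hV.exists_mem_beyond (a v) (b v)
  have h₂_pos : 0 < planeDet (b v) (b w) := by
    refine h₂.lt_of_ne' fun h => ?_
    have hbv := eq_planeDet_smul_add (hV.det_eq w hw) (b v)
    rw [h, zero_smul, zero_add] at hbv
    have hdet := hV.det_eq v hv
    rw [hbv, planeDet_smul_right] at hdet
    linarith [mul_nonpos_of_nonneg_of_nonpos h₁ (h₂' h)]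
  refine ⟨w, hw, ?_⟩
  rcases h₁.eq_or_lt with h | h₁_pos
  · refine (eq_of_planeDet_eq_zero (v' := -a v) (hV.det_eq w hw) ?_ h.symm h₂_pos).symm
    rw [planeDet_neg_right, planeDet_swap, neg_neg, hV.det_eq v hv]
  · have hvw : v = w := hV.eq_of_mem w hw v hv (b v) h₁_pos h₂_pos
      (hV.det_eq v hv ▸ zero_le_one) (planeDet_self _).ge
    rw [hvw, planeDet_self] at h₂_pos
    exact absurd h₂_pos (lt_irrefl 0)

lemma exists_isSmoothFan (hV : IsConeSystem V a b) :
    ∃ s, IsSmoothFan (V.image a) s ∧ ∀ v ∈ V, s (a v) = b v := by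
  choose! next next_mem a_next using fun v (hv : v ∈ V) => hV.exists_next hv
  have : Nonempty ι := (hV.exists_mem 0).nonempty
  have hs : ∀ v ∈ V, b (Function.invFunOn a V (a v)) = b v := fun v hv =>
    congrArg b (hV.injOn.leftInvOn_invFunOn hv)
  refine ⟨fun u => b (Function.invFunOn a V u), ⟨?_, ?_, ?_, fun x => ?_⟩, hs⟩
  · refine Finset.forall_mem_image.2 fun v hv => ?_
    rw [hs v hv, ← a_next v hv]
    exact Finset.mem_image_of_mem a (next_mem v hv)
  · exact Finset.forall_mem_image.2 fun v hv => by rw [hs v hv, hV.det_eq v hv]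
  · refine Finset.forall_mem_image.2 fun v hv => Finset.forall_mem_image.2 fun w hw h₁ h₂ => ?_
    rw [hs v hv] at h₂
    have hwv : w = v := hV.eq_of_mem v hv w hw (a w) h₁ h₂ (planeDet_self _).ge
      (hV.det_eq w hw ▸ zero_le_one)
    rw [hwv, planeDet_self] at h₁
    exact h₁.false
  · obtain ⟨v, hv, h₁, h₂⟩ := hV.exists_mem x
    exact ⟨a v, Finset.mem_image_of_mem a hv, h₁, by rwa [hs v hv]⟩

end IsConeSystem

/-! ### Faces and normal cones of lattice polytopes -/

section Exposed

variable {E : Type*} [AddCommGroup E] [Module ℝ E] [TopologicalSpace E]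

-- Separate the extreme point from the hull of the others; by the Krein–Milman theorem the face on
-- which the separating functional is maximal contains nothing else.
lemma extremePoints_subset_exposedPoints [T2Space E] [IsTopologicalAddGroup E]
    [ContinuousSMul ℝ E] [LocallyConvexSpace ℝ E] {K : Set E} (hK : IsCompact K)
    (hconv : Convex ℝ K) (hfin : (K.extremePoints ℝ).Finite) :
    K.extremePoints ℝ ⊆ K.exposedPoints ℝ := by
  intro v hv
  have hnot : v ∉ convexHull ℝ (K.extremePoints ℝ \ {v}) :=
    convexIndependent_set_iff_notMem_convexHull_sdiff.1 hconv.convexIndependent_extremePoints v hv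
  obtain ⟨f, t, hft, htv⟩ := geometric_hahn_banach_closed_point (convex_convexHull ℝ _)
    ((hfin.subset Set.sdiff_subset).isClosed_convexHull ℝ) hnot
  have hface : IsExposed ℝ K (f.toExposed K) := ContinuousLinearMap.toExposed.isExposed
  obtain ⟨m, hmK, hm⟩ := hK.exists_isMaxOn ⟨v, hv.1⟩ f.continuous.continuousOn
  have ext_subset : (f.toExposed K).extremePoints ℝ ⊆ {v} := by
    rw [hface.isExtreme.extremePoints_eq]
    rintro w ⟨⟨-, hw_max⟩, hw⟩
    by_contra hwv
    exact ((hft w (subset_convexHull ℝ _ ⟨hw, hwv⟩)).trans htv).not_ge (hw_max v hv.1)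
  have face_subset : f.toExposed K ⊆ {v} := by
    rw [← closure_convexHull_extremePoints (hface.isCompact hK) (hface.convex hconv)]
    exact closure_minimal (convexHull_min ext_subset (convex_singleton v)) isClosed_singleton
  obtain rfl : m = v := face_subset ⟨hmK, hm⟩
  exact ⟨hmK, f, fun y hy => ⟨hm hy, fun hy' => face_subset ⟨hy, fun z hz => (hm hz).trans hy'⟩⟩⟩

end Exposed

lemma subset_frontier_of_isExposed {E : Type*} [NormedAddCommGroup E] [NormedSpace ℝ E]
    {K F : Set E} (hF : IsExposed ℝ K F) (hne : F ≠ K) : F ⊆ frontier K := by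
  intro x hx
  obtain ⟨l, rfl⟩ := hF ⟨x, hx⟩
  refine ⟨subset_closure hx.1, fun hinterior => hne ?_⟩
  have hmax : IsLocalMax l x :=
    Filter.eventually_of_mem (mem_interior_iff_mem_nhds.1 hinterior) fun y hy => hx.2 y hy
  have hl : l = 0 := hmax.hasFDerivAt_eq_zero l.hasFDerivAt
  simp [hl]

lemma finite_inter_intLattice {d : ℕ} {K : Set (Fin d → ℝ)} (hK : IsCompact K) :
    (K ∩ intLattice d).Finite := by
  rw [intLattice_eq_range, ← Set.image_preimage_eq_inter_range]
  exact (isClosedEmbedding_latticeEmb.isCompact_preimage hK).finite_of_discrete.image _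

namespace IsLatticePolytope

variable {d : ℕ} {P : Set (Fin d → ℝ)}

lemma isCompact (hP : IsLatticePolytope P) : IsCompact P := by
  obtain ⟨V, hV, -, -, rfl⟩ := hP
  exact hV.isCompact_convexHull ℝ

lemma convex (hP : IsLatticePolytope P) : Convex ℝ P := by
  obtain ⟨V, -, -, -, rfl⟩ := hP
  exact convex_convexHull ℝ V

lemma finite_extremePoints (hP : IsLatticePolytope P) : (P.extremePoints ℝ).Finite := by
  obtain ⟨V, hV, -, -, rfl⟩ := hP
  exact hV.subset extremePoints_convexHull_subset

lemma extremePoints_subset_intLattice (hP : IsLatticePolytope P) :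
    P.extremePoints ℝ ⊆ intLattice d := by
  obtain ⟨V, -, -, hV, rfl⟩ := hP
  exact extremePoints_convexHull_subset.trans hV

lemma convexHull_extremePoints (hP : IsLatticePolytope P) :
    convexHull ℝ (P.extremePoints ℝ) = P := by
  rw [← (hP.finite_extremePoints.isClosed_convexHull ℝ).closure_eq]
  exact closure_convexHull_extremePoints hP.isCompact hP.convex

lemma extremePoints_nonempty (hP : IsLatticePolytope P) : (P.extremePoints ℝ).Nonempty := by
  rw [← convexHull_nonempty_iff (𝕜 := ℝ), hP.convexHull_extremePoints]
  obtain ⟨V, -, hV, -, rfl⟩ := hP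
  exact hV.convexHull

lemma exists_finset_extremePoints_eq (hP : IsLatticePolytope P) :
    ∃ V : Finset (Fin d → ℤ), P.extremePoints ℝ = latticeEmb '' (V : Set (Fin d → ℤ)) := by
  refine ⟨(hP.finite_extremePoints.preimage latticeEmb_injective.injOn).toFinset, ?_⟩
  rw [Set.Finite.coe_toFinset]
  exact (Set.image_preimage_eq_of_subset hP.extremePoints_subset_intLattice).symm

lemma isFace_singleton (hP : IsLatticePolytope P) {v : Fin d → ℝ} (hv : v ∈ P.extremePoints ℝ) :
    IsFace P {v} :=
  ⟨Set.singleton_nonempty v, mem_exposedPoints_iff_exposed_singleton.1 <|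
    extremePoints_subset_exposedPoints hP.isCompact hP.convex hP.finite_extremePoints hv⟩

lemma mem_normalCone_singleton_iff (hP : IsLatticePolytope P) {v w : Fin d → ℝ} :
    w ∈ normalCone P {v} ↔ ∀ x ∈ P.extremePoints ℝ, w ⬝ᵥ v ≤ w ⬝ᵥ x := by
  have hconv : Convex ℝ {x | w ⬝ᵥ v ≤ w ⬝ᵥ x} :=
    convex_halfSpace_ge ⟨dotProduct_add w, fun c => dotProduct_smul c w⟩ _
  simp only [normalCone, Set.mem_singleton_iff, forall_eq, Set.mem_ofPred_eq]
  refine ⟨fun h x hx => h x hx.1, fun h x hx => ?_⟩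
  rw [← hP.convexHull_extremePoints] at hx
  exact convexHull_min h hconv hx

lemma interior_normalCone_nonempty (hP : IsLatticePolytope P) {v : Fin d → ℝ}
    (hv : v ∈ P.extremePoints ℝ) : (interior (normalCone P {v})).Nonempty := by
  obtain ⟨-, l, hl⟩ :=
    extremePoints_subset_exposedPoints hP.isCompact hP.convex hP.finite_extremePoints hv
  set W := ⋂ x ∈ P.extremePoints ℝ \ {v}, {w : Fin d → ℝ | w ⬝ᵥ v < w ⬝ᵥ x}
  have hW : IsOpen W := (hP.finite_extremePoints.subset Set.sdiff_subset).isOpen_biInter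
    fun x _ => isOpen_lt (by fun_prop) (by fun_prop)
  have hsub : W ⊆ normalCone P {v} := by
    refine fun w hw => hP.mem_normalCone_singleton_iff.2 fun x hx => ?_
    rcases eq_or_ne x v with rfl | hxv
    · rfl
    · exact (Set.mem_iInter₂.1 hw x ⟨hx, hxv⟩).le
  refine ⟨-(dotProductEquiv ℝ (Fin d)).symm l, interior_maximal hsub hW ?_⟩
  refine Set.mem_iInter₂.2 fun x hx => ?_
  have hdot : ∀ z, (dotProductEquiv ℝ (Fin d)).symm l ⬝ᵥ z = l z := fun z =>
    LinearMap.congr_fun ((dotProductEquiv ℝ (Fin d)).apply_symm_apply l) z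
  rw [Set.mem_ofPred_eq, neg_dotProduct, neg_dotProduct, hdot, hdot, neg_lt_neg_iff]
  exact lt_of_not_ge fun h => hx.2 ((hl x hx.1.1).2 h)

end IsLatticePolytope

lemma mem_hull_pair_iff {a b x : Fin 2 → ℝ} (hab : planeDet a b = 1) :
    x ∈ PointedCone.hull ℝ {a, b} ↔ 0 ≤ planeDet a x ∧ 0 ≤ planeDet x b := by
  rw [PointedCone.hull, Submodule.mem_span_pair]
  constructor
  · rintro ⟨α, β, rfl⟩
    change 0 ≤ planeDet a ((α : ℝ) • a + (β : ℝ) • b) ∧ 0 ≤ planeDet ((α : ℝ) • a + (β : ℝ) • b) b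
    rw [planeDet_add_left, planeDet_add_right, planeDet_smul_left, planeDet_smul_left,
      planeDet_smul_right, planeDet_smul_right, planeDet_self, planeDet_self, hab, mul_zero,
      mul_zero, mul_one, mul_one, zero_add, add_zero]
    exact ⟨β.2, α.2⟩
  · rintro ⟨h₁, h₂⟩
    exact ⟨⟨_, h₂⟩, ⟨_, h₁⟩, (eq_planeDet_smul_add hab x).symm⟩

namespace IsUnimodularCone

lemma exists_basis {d : ℕ} {σ : Set (Fin d → ℝ)} (hσ : IsUnimodularCone σ)
    (hinterior : (interior σ).Nonempty) : ∃ e : Module.Basis (Fin d) ℤ (Fin d → ℤ),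
      σ = PointedCone.hull ℝ (Set.range fun j => latticeEmb (e j)) := by
  obtain ⟨e, S, rfl⟩ := hσ
  lift S to Finset (Fin d) using S.toFinite
  set g : Fin d → Fin d → ℝ := fun j => latticeEmb (e j)
  have hspan : Submodule.span ℝ (S.image g : Set (Fin d → ℝ)) = ⊤ := by
    rw [Finset.coe_image]
    exact Submodule.eq_top_of_nonempty_interior' _
      (hinterior.mono (interior_mono (PointedCone.hull_le_span ℝ _)))
  have hcard := finrank_span_finset_le_card (R := ℝ) (S.image g)
  rw [Set.finrank, hspan, finrank_top, Module.finrank_fin_fun] at hcard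
  have hS : S = Finset.univ := Finset.eq_univ_of_card S <| (Finset.card_le_univ S).antisymm <| by
    rw [Fintype.card_fin]
    exact hcard.trans Finset.card_image_le
  refine ⟨e, ?_⟩
  rw [hS, Finset.coe_univ, Set.image_univ]
  rfl

lemma exists_planeDet_eq_one {σ : Set (Fin 2 → ℝ)} (hσ : IsUnimodularCone σ)
    (hinterior : (interior σ).Nonempty) : ∃ a b : Fin 2 → ℤ, planeDet a b = 1 ∧
      ∀ u, latticeEmb u ∈ σ ↔ 0 ≤ planeDet a u ∧ 0 ≤ planeDet u b := by
  obtain ⟨e, rfl⟩ := hσ.exists_basis hinterior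
  have hrange : Set.range (fun j => latticeEmb (e j)) = {latticeEmb (e 0), latticeEmb (e 1)} := by
    ext x
    simp [Fin.exists_fin_two, eq_comm]
  have hunit : IsUnit (planeDet (e 0) (e 1)) := by
    have h := (Pi.basisFun ℤ (Fin 2)).isUnit_det e
    rw [Pi.basisFun_det_apply, Matrix.det_fin_two] at h
    exact h
  have mem_iff : ∀ {a b : Fin 2 → ℤ}, planeDet a b = 1 → ∀ u,
      latticeEmb u ∈ PointedCone.hull ℝ {latticeEmb a, latticeEmb b} ↔
        0 ≤ planeDet a u ∧ 0 ≤ planeDet u b := fun hab u => by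
    rw [mem_hull_pair_iff (by rw [planeDet_latticeEmb, hab, Int.cast_one]), planeDet_latticeEmb,
      planeDet_latticeEmb, Int.cast_nonneg_iff, Int.cast_nonneg_iff]
  rw [hrange]
  rcases Int.isUnit_iff.1 hunit with h | h
  · exact ⟨e 0, e 1, h, mem_iff h⟩
  · rw [planeDet_swap, neg_inj] at h
    exact ⟨e 1, e 0, h, Set.pair_comm (latticeEmb (e 0)) _ ▸ mem_iff h⟩

end IsUnimodularCone

/-- The face of `P` on which the integral functional `m` takes the value `k`. -/
def latticeFace {d : ℕ} (P : Set (Fin d → ℝ)) (m : Fin d → ℤ) (k : ℤ) : Set (Fin d → ℝ) :=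
  {x ∈ P | latticeEmb m ⬝ᵥ x = k}

section LatticeFace

variable {d : ℕ} {P : Set (Fin d → ℝ)}

lemma isFace_latticeFace {m : Fin d → ℤ} {k : ℤ} (hne : (latticeFace P m k).Nonempty)
    (hmin : ∀ x ∈ P, (k : ℝ) ≤ latticeEmb m ⬝ᵥ x) : IsFace P (latticeFace P m k) := by
  refine ⟨hne, fun _ => ⟨-(dotProductEquiv ℝ (Fin d) (latticeEmb m)).toContinuousLinearMap, ?_⟩⟩
  obtain ⟨y, hy, hyk⟩ := hne
  ext x
  simp only [latticeFace, Set.mem_ofPred_eq, neg_apply, neg_le_neg_iff,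
    LinearMap.coe_toContinuousLinearMap', dotProductEquiv_apply_apply]
  exact and_congr_right fun hx => ⟨fun h z hz => h ▸ hmin z hz,
    fun h => (hyk ▸ h y hy).antisymm (hmin x hx)⟩

lemma convex_latticeFace (hP : Convex ℝ P) (m : Fin d → ℤ) (k : ℤ) :
    Convex ℝ (latticeFace P m k) :=
  hP.inter (convex_hyperplane ⟨dotProduct_add _, fun c => dotProduct_smul c _⟩ _)

lemma latticeEmb_add_nsmul_mem {F : Set (Fin d → ℝ)} (hF : Convex ℝ F) {y e : Fin d → ℤ} {j l : ℕ}
    (hjl : j ≤ l) (hy : latticeEmb y ∈ F) (hyl : latticeEmb (y + l • e) ∈ F) :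
    latticeEmb (y + j • e) ∈ F := by
  rcases hjl.eq_or_lt with rfl | hlt
  · exact hyl
  have hl : (l : ℝ) ≠ 0 := Nat.cast_ne_zero.2 (Nat.ne_zero_of_lt hlt)
  have h := hF.add_smul_sub_mem hy hyl
    (t := j / l) ⟨by positivity, div_le_one_of_le₀ (Nat.cast_le.2 hjl) l.cast_nonneg⟩
  rwa [map_add, add_sub_cancel_left, map_nsmul, ← Nat.cast_smul_eq_nsmul ℝ, smul_smul,
    div_mul_cancel₀ _ hl, Nat.cast_smul_eq_nsmul, ← map_nsmul, ← map_add] at h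

lemma le_latticeLength {F : Set (Fin d → ℝ)} (hF : Convex ℝ F) (hfin : (F ∩ intLattice d).Finite)
    {y e : Fin d → ℤ} (he : e ≠ 0) {l : ℕ} (hy : latticeEmb y ∈ F)
    (hyl : latticeEmb (y + l • e) ∈ F) : l ≤ latticeLength F := by
  have hinj : Function.Injective fun j : ℕ => latticeEmb (y + j • e) := fun i j hij => by
    have h := add_left_cancel (latticeEmb_injective hij)
    rw [← natCast_zsmul, ← natCast_zsmul e j] at h
    exact Int.natCast_inj.1 (smul_left_injective ℤ he h)
  have hsub : (fun j : ℕ => latticeEmb (y + j • e)) '' Finset.range (l + 1) ⊆ F ∩ intLattice d := by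
    rintro _ ⟨j, hj, rfl⟩
    exact ⟨latticeEmb_add_nsmul_mem hF (Finset.mem_range_succ_iff.1 hj) hy hyl,
      latticeEmb_mem_intLattice _⟩
  have hcard := Set.ncard_le_ncard hsub hfin
  rw [Set.ncard_image_of_injective _ hinj, Set.ncard_coe_finset, Finset.card_range] at hcard
  exact Nat.le_sub_of_add_le hcard

end LatticeFace

lemma isEdge_latticeFace {P : Set (Fin 2 → ℝ)} {p m y z : Fin 2 → ℤ} {k : ℤ}
    (hpm : planeDet p m = 1) (hy : latticeEmb y ∈ latticeFace P m k)
    (hz : latticeEmb z ∈ latticeFace P m k) (hyz : y ≠ z)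
    (hmin : ∀ x ∈ P, (k : ℝ) ≤ latticeEmb m ⬝ᵥ x) : IsEdge P (latticeFace P m k) := by
  refine ⟨isFace_latticeFace ⟨_, hy⟩ hmin, ?_⟩
  have hspan : vectorSpan ℝ (latticeFace P m k) ≤ Submodule.span ℝ {rot (latticeEmb m)} := by
    rw [vectorSpan_def, Submodule.span_le]
    rintro _ ⟨x, hx, z, hz, rfl⟩
    refine Submodule.mem_span_singleton.2 ⟨latticeEmb p ⬝ᵥ (x - z), ?_⟩
    have h := planeDet_smul_eq_rot (latticeEmb p) (latticeEmb m) (x - z)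
    rw [planeDet_latticeEmb, hpm, Int.cast_one, one_smul, dotProduct_sub (latticeEmb m), hx.2, hz.2,
      sub_self, zero_smul, sub_zero] at h
    exact h.symm
  refine le_antisymm ((Submodule.finrank_mono hspan).trans ?_) ?_
  · exact (finrank_span_le_card _).trans_eq (by simp)
  refine Submodule.one_le_finrank_iff.2 ((Submodule.ne_bot_iff _).2
    ⟨_, vsub_mem_vectorSpan ℝ hy hz, ?_⟩)
  exact sub_ne_zero.2 fun h => hyz (latticeEmb_injective h)

lemma sub_le_latticeLength_latticeFace {P : Set (Fin 2 → ℝ)} (hP : IsLatticePolytope P)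
    {p m y z : Fin 2 → ℤ} {k : ℤ} (hpm : planeDet p m = 1)
    (hy : latticeEmb y ∈ latticeFace P m k) (hz : latticeEmb z ∈ latticeFace P m k) :
    p ⬝ᵥ z - p ⬝ᵥ y ≤ latticeLength (latticeFace P m k) := by
  rcases le_total (p ⬝ᵥ z - p ⬝ᵥ y) 0 with h | h
  · exact h.trans (Int.natCast_nonneg _)
  obtain ⟨l, hl⟩ := Int.eq_ofNat_of_zero_le h
  have hm : m ⬝ᵥ z = m ⬝ᵥ y := by
    have := hz.2.trans hy.2.symm
    rw [latticeEmb_dotProduct, latticeEmb_dotProduct] at this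
    exact_mod_cast this
  have hzy : z = y + l • rot m := by
    have h := planeDet_smul_eq_rot p m (z - y)
    rw [hpm, one_smul, dotProduct_sub, dotProduct_sub, hm, sub_self, zero_smul, sub_zero, hl,
      natCast_zsmul] at h
    rw [← h, add_sub_cancel]
  rw [hl, Nat.cast_le]
  exact le_latticeLength (convex_latticeFace hP.convex m k)
    ((finite_inter_intLattice hP.isCompact).subset
      (Set.inter_subset_inter_left _ fun x hx => hx.1)) (rot_ne_zero hpm) hy (hzy ▸ hz)

/-! ### The fan of a smooth polygon -/

lemma IsSmoothFan.edgeLen_eq_sub {U : Finset (Fin 2 → ℤ)} {s : (Fin 2 → ℤ) → Fin 2 → ℤ}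
    (hU : IsSmoothFan U s) {h : (Fin 2 → ℤ) → ℤ} {u y z : Fin 2 → ℤ} (hu : u ∈ U)
    (hy : h u = u ⬝ᵥ y) (hz : h (s u) = s u ⬝ᵥ z) (hz' : h (s (s u)) = s (s u) ⬝ᵥ z) :
    edgeLen s h u = u ⬝ᵥ z - u ⬝ᵥ y := by
  have hsum := congrArg (· ⬝ᵥ z) (hU.add_succ_succ hu)
  simp only [add_dotProduct, smul_dotProduct, smul_eq_mul] at hsum
  rw [edgeLen, hy, hz, hz', ← hsum]
  ring

lemma eq_of_dotProduct_le {a b x v w : Fin 2 → ℤ} (hab : planeDet a b = 1)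
    (hax : 0 < planeDet a x) (hxb : 0 < planeDet x b) (ha : a ⬝ᵥ v ≤ a ⬝ᵥ w)
    (hb : b ⬝ᵥ v ≤ b ⬝ᵥ w) (hx : x ⬝ᵥ w ≤ x ⬝ᵥ v) : w = v := by
  rw [eq_planeDet_smul_add hab x] at hx
  simp only [add_dotProduct, smul_dotProduct, smul_eq_mul] at hx
  exact eq_of_dotProduct_eq hab (by nlinarith) (by nlinarith)

lemma IsLatticePolytope.latticeEmb_mem_normalCone_iff {d : ℕ} {P : Set (Fin d → ℝ)}
    (hP : IsLatticePolytope P) {V : Finset (Fin d → ℤ)}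
    (hV : P.extremePoints ℝ = latticeEmb '' (V : Set (Fin d → ℤ))) {m v : Fin d → ℤ} :
    latticeEmb m ∈ normalCone P {latticeEmb v} ↔ ∀ w ∈ V, m ⬝ᵥ v ≤ m ⬝ᵥ w := by
  rw [hP.mem_normalCone_singleton_iff, hV, Set.forall_mem_image]
  simp only [latticeEmb_dotProduct, Int.cast_le, Finset.mem_coe]

/-- The points of `V` are the vertices of a smooth lattice polygon, and the inner normal cone at
the vertex `v` is generated by the lattice basis `a v, b v`. -/
structure IsNormalConeSystem (V : Finset (Fin 2 → ℤ)) (a b : (Fin 2 → ℤ) → Fin 2 → ℤ) : Prop where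
  nonempty : V.Nonempty
  det_eq : ∀ v ∈ V, planeDet (a v) (b v) = 1
  le_iff : ∀ v ∈ V, ∀ u : Fin 2 → ℤ,
    (∀ w ∈ V, u ⬝ᵥ v ≤ u ⬝ᵥ w) ↔ 0 ≤ planeDet (a v) u ∧ 0 ≤ planeDet u (b v)

namespace IsNormalConeSystem

variable {V : Finset (Fin 2 → ℤ)} {a b : (Fin 2 → ℤ) → Fin 2 → ℤ} {v w : Fin 2 → ℤ}

lemma left_le (hV : IsNormalConeSystem V a b) (hv : v ∈ V) (hw : w ∈ V) : a v ⬝ᵥ v ≤ a v ⬝ᵥ w :=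
  (hV.le_iff v hv _).2 ⟨(planeDet_self _).ge, hV.det_eq v hv ▸ zero_le_one⟩ w hw

lemma right_le (hV : IsNormalConeSystem V a b) (hv : v ∈ V) (hw : w ∈ V) : b v ⬝ᵥ v ≤ b v ⬝ᵥ w :=
  (hV.le_iff v hv _).2 ⟨hV.det_eq v hv ▸ zero_le_one, (planeDet_self _).ge⟩ w hw

lemma isConeSystem (hV : IsNormalConeSystem V a b) : IsConeSystem V a b where
  det_eq := hV.det_eq
  exists_mem x := by
    obtain ⟨v, hv, hmin⟩ := V.exists_min_image (x ⬝ᵥ ·) hV.nonempty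
    exact ⟨v, hv, (hV.le_iff v hv x).1 hmin⟩
  eq_of_mem v hv w hw x hax hxb hax' hxb' :=
    eq_of_dotProduct_le (hV.det_eq v hv) hax hxb (hV.left_le hv hw) (hV.right_le hv hw)
      ((hV.le_iff w hw x).2 ⟨hax', hxb'⟩ v hv)

lemma left_lt (hV : IsNormalConeSystem V a b) (hv : v ∈ V) (hw : w ∈ V) (hvw : a w = b v) :
    a v ⬝ᵥ v < a v ⬝ᵥ w := by
  refine (hV.left_le hv hw).lt_of_ne fun h => ?_
  have hb : b v ⬝ᵥ v = b v ⬝ᵥ w := (hV.right_le hv hw).antisymm (hvw ▸ hV.left_le hw hv)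
  obtain rfl := eq_of_dotProduct_eq (hV.det_eq v hv) h hb
  have hdet := hV.det_eq v hv
  rw [hvw, planeDet_self] at hdet
  exact zero_ne_one hdet

lemma exists_isSmoothFan (hV : IsNormalConeSystem V a b) :
    ∃ s h, IsSmoothFan (V.image a) s ∧ (∀ v ∈ V, h (a v) = a v ⬝ᵥ v) ∧
      ∀ v ∈ V, ∃ w ∈ V, a w = b v ∧ edgeLen s h (a v) = a v ⬝ᵥ w - a v ⬝ᵥ v := by
  obtain ⟨s, hU, hs⟩ := hV.isConeSystem.exists_isSmoothFan
  set h : (Fin 2 → ℤ) → ℤ := fun u => V.inf' hV.nonempty (u ⬝ᵥ ·)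
  have h_eq : ∀ {u v}, v ∈ V → (∀ w ∈ V, u ⬝ᵥ v ≤ u ⬝ᵥ w) → h u = u ⬝ᵥ v := fun hv hmin =>
    (Finset.inf'_le _ hv).antisymm (Finset.le_inf' _ _ hmin)
  have h_left : ∀ v ∈ V, h (a v) = a v ⬝ᵥ v := fun v hv => h_eq hv fun _ => hV.left_le hv
  have h_right : ∀ v ∈ V, h (b v) = b v ⬝ᵥ v := fun v hv => h_eq hv fun _ => hV.right_le hv
  refine ⟨s, h, hU, h_left, fun v hv => ?_⟩
  obtain ⟨w, hw, hvw⟩ := hV.isConeSystem.exists_next hv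
  refine ⟨w, hw, hvw, hU.edgeLen_eq_sub (Finset.mem_image_of_mem a hv) (h_left v hv) ?_ ?_⟩
  · rw [hs v hv, ← hvw, h_left w hw]
  · rw [hs v hv, ← hvw, hs w hw, h_right w hw]

lemma exists_le_edgeLength (hV : IsNormalConeSystem V a b) {P : Set (Fin 2 → ℝ)}
    (hP : IsLatticePolytope P) (hPV : P.extremePoints ℝ = latticeEmb '' (V : Set (Fin 2 → ℤ)))
    (hv : v ∈ V) (hw : w ∈ V) (hvw : a w = b v) :
    ∃ l ∈ edgeLengths P, a v ⬝ᵥ w - a v ⬝ᵥ v ≤ l := by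
  have hVP : ∀ v ∈ V, latticeEmb v ∈ P := fun v hv =>
    extremePoints_subset (hPV ▸ Set.mem_image_of_mem _ hv)
  have hvF : latticeEmb v ∈ latticeFace P (b v) (b v ⬝ᵥ v) := ⟨hVP v hv, latticeEmb_dotProduct ..⟩
  have hwF : latticeEmb w ∈ latticeFace P (b v) (b v ⬝ᵥ v) := by
    refine ⟨hVP w hw, ?_⟩
    rw [latticeEmb_dotProduct, (hV.right_le hv hw).antisymm (hvw ▸ hV.left_le hw hv)]
  have hmin : ∀ x ∈ P, ((b v ⬝ᵥ v : ℤ) : ℝ) ≤ latticeEmb (b v) ⬝ᵥ x := fun x hx => by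
    rw [← latticeEmb_dotProduct]
    exact (hP.latticeEmb_mem_normalCone_iff hPV).2 (fun _ => hV.right_le hv) _ rfl x hx
  have hne : v ≠ w := by
    rintro rfl
    exact (hV.left_lt hv hw hvw).false
  exact ⟨_, ⟨_, isEdge_latticeFace (hV.det_eq v hv) hvF hwF hne hmin, rfl⟩,
    sub_le_latticeLength_latticeFace hP (hV.det_eq v hv) hvF hwF⟩

end IsNormalConeSystem

namespace IsSmoothPolygon

variable {P : Set (Fin 2 → ℝ)}

lemma exists_isNormalConeSystem (hP : IsSmoothPolygon P) {V : Finset (Fin 2 → ℤ)}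
    (hV : P.extremePoints ℝ = latticeEmb '' (V : Set (Fin 2 → ℤ))) :
    ∃ a b, IsNormalConeSystem V a b := by
  have hcone : ∀ v ∈ V, ∃ a b, planeDet a b = 1 ∧ ∀ u : Fin 2 → ℤ,
      (∀ w ∈ V, u ⬝ᵥ v ≤ u ⬝ᵥ w) ↔ 0 ≤ planeDet a u ∧ 0 ≤ planeDet u b := by
    intro v hv
    have hvP : latticeEmb v ∈ P.extremePoints ℝ := hV ▸ Set.mem_image_of_mem _ hv
    obtain ⟨a, b, hab, hmem⟩ :=
      (hP.2 _ ⟨_, hP.1.1.isFace_singleton hvP, rfl⟩).exists_planeDet_eq_one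
        (hP.1.1.interior_normalCone_nonempty hvP)
    exact ⟨a, b, hab, fun u => (hP.1.1.latticeEmb_mem_normalCone_iff hV).symm.trans (hmem u)⟩
  choose! a b hab hmem using hcone
  have hne := hP.1.1.extremePoints_nonempty
  rw [hV, Set.image_nonempty, Finset.coe_nonempty] at hne
  exact ⟨a, b, hne, hab, hmem⟩

lemma exists_isSmoothFan (hP : IsSmoothPolygon P) :
    ∃ U s h, IsSmoothFan U s ∧ U.card = numVertices P ∧ P ⊆ supportRegion U h ∧
      ∀ u ∈ U, 1 ≤ edgeLen s h u ∧ ∃ l ∈ edgeLengths P, edgeLen s h u ≤ l := by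
  obtain ⟨V, hV⟩ := hP.1.1.exists_finset_extremePoints_eq
  obtain ⟨a, b, hab⟩ := hP.exists_isNormalConeSystem hV
  obtain ⟨s, h, hU, h_left, hlen⟩ := hab.exists_isSmoothFan
  refine ⟨V.image a, s, h, hU, ?_, fun x hx => ?_, ?_⟩
  · rw [numVertices, hV, Set.ncard_image_of_injective _ latticeEmb_injective, Set.ncard_coe_finset,
      Finset.card_image_of_injOn hab.isConeSystem.injOn]
  · refine Finset.forall_mem_image.2 fun v hv => ?_
    rw [h_left v hv, ← latticeEmb_dotProduct]
    exact (hP.1.1.latticeEmb_mem_normalCone_iff hV).2 (fun _ => hab.left_le hv) _ rfl x hx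
  · refine Finset.forall_mem_image.2 fun v hv => ?_
    obtain ⟨w, hw, hvw, hvw_len⟩ := hlen v hv
    have hlt := hab.left_lt hv hw hvw
    exact ⟨by omega, hvw_len ▸ hab.exists_le_edgeLength hP.1.1 hV hv hw hvw⟩

end IsSmoothPolygon

/-! ### Area -/

lemma volumeReal_le_of_subset_latticeBox {d : ℕ} {P : Set (Fin d → ℝ)}
    {A : Matrix.SpecialLinearGroup (Fin d) ℤ} {c ℓ : Fin d → ℤ} (hℓ : 0 ≤ ℓ)
    (hP : P ⊆ latticeBox A c ℓ) : volume.real P ≤ ∏ i, (ℓ i : ℝ) := by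
  have hℓ' : ∀ i ∈ Finset.univ, (0 : ℝ) ≤ ℓ i := fun i _ => Int.cast_nonneg (hℓ i)
  refine ENNReal.toReal_le_of_le_ofReal (Finset.prod_nonneg hℓ') ((measure_mono hP).trans_eq ?_)
  rw [volume_latticeBox, ENNReal.ofReal_prod_of_nonneg hℓ']

lemma IsLatticePolytope.bddAbove_edgeLengths {d : ℕ} {P : Set (Fin d → ℝ)}
    (hP : IsLatticePolytope P) : BddAbove (edgeLengths P) := by
  refine ⟨(P ∩ intLattice d).ncard, ?_⟩
  rintro _ ⟨F, hF, rfl⟩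
  exact (Nat.sub_le _ _).trans <| Set.ncard_le_ncard
    (Set.inter_subset_inter_left _ hF.1.2.subset) (finite_inter_intLattice hP.isCompact)

namespace IsSmoothPolygon

variable {P : Set (Fin 2 → ℝ)} {b : ℕ}

lemma exists_isGreatest_edgeLengths (hP : IsSmoothPolygon P) :
    ∃ b, IsGreatest (edgeLengths P) b := by
  obtain ⟨U, s, h, hU, -, -, hlen⟩ := hP.exists_isSmoothFan
  obtain ⟨u, hu⟩ := hU.nonempty
  obtain ⟨-, l, hl, -⟩ := hlen u hu
  have hbdd := hP.1.1.bddAbove_edgeLengths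
  exact ⟨_, Nat.sSup_mem ⟨l, hl⟩ hbdd, fun _ => le_csSup hbdd⟩

lemma exists_isSmoothFan_edgeLen_le (hP : IsSmoothPolygon P)
    (hb : b ∈ upperBounds (edgeLengths P)) :
    ∃ U s h, IsSmoothFan U s ∧ U.card = numVertices P ∧ P ⊆ supportRegion U h ∧
      ∀ u ∈ U, 1 ≤ edgeLen s h u ∧ edgeLen s h u ≤ b := by
  obtain ⟨U, s, h, hU, hcard, hPU, hlen⟩ := hP.exists_isSmoothFan
  refine ⟨U, s, h, hU, hcard, hPU, fun u hu => ?_⟩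
  obtain ⟨hpos, l, hl, hle⟩ := hlen u hu
  exact ⟨hpos, hle.trans (Int.ofNat_le.2 (hb hl))⟩

lemma volumeReal_le_of_numVertices_eq_three (hP : IsSmoothPolygon P)
    (hb : b ∈ upperBounds (edgeLengths P)) (hn : numVertices P = 3) :
    volume.real P ≤ (1 / 2 : ℝ) * (b : ℝ) ^ 2 := by
  obtain ⟨U, s, h, hU, hcard, hPU, hlen⟩ := hP.exists_isSmoothFan_edgeLen_le hb
  obtain ⟨r, hr, A, c, htri⟩ := hU.exists_supportRegion_subset_cornerTriangle (hcard.trans hn) h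
  have hL₀ : (0 : ℝ) ≤ edgeLen s h r := by exact_mod_cast (zero_le_one.trans (hlen r hr).1)
  have hLb : (edgeLen s h r : ℝ) ≤ b := by exact_mod_cast (hlen r hr).2
  have hvol : volume.real P ≤ (edgeLen s h r : ℝ) ^ 2 / 2 := by
    refine ENNReal.toReal_le_of_le_ofReal (by positivity)
      ((measure_mono (hPU.trans htri)).trans_eq ?_)
    rw [volume_preimage_unimodularMap, volume_cornerTriangle _ hL₀]
  have := pow_le_pow_left₀ hL₀ hLb 2
  linarith

lemma volumeReal_le_of_numVertices_eq_four (hP : IsSmoothPolygon P)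
    (hb : b ∈ upperBounds (edgeLengths P)) (hn : numVertices P = 4) :
    volume.real P ≤ (b : ℝ) ^ 2 := by
  obtain ⟨U, s, h, hU, hcard, hPU, hlen⟩ := hP.exists_isSmoothFan_edgeLen_le hb
  obtain ⟨r, hr, -, -, A, c, hbox⟩ := hU.exists_supportRegion_subset_latticeBox_of_card_eq_four
    (hcard.trans hn) fun u hu => (hlen u hu).2
  have hℓ : ![edgeLen s h r, b] ≤ fun _ => (b : ℤ) :=
    Fin.forall_fin_two.2 ⟨(hlen r hr).2, le_rfl⟩
  simpa using volumeReal_le_of_subset_latticeBox (fun _ => Int.natCast_nonneg b)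
    ((hPU.trans hbox).trans (latticeBox_mono A c hℓ))

lemma volumeReal_le_of_numVertices_eq_add_five (hP : IsSmoothPolygon P)
    (hb : b ∈ upperBounds (edgeLengths P)) {k : ℕ} (hn : numVertices P = k + 5) :
    volume.real P ≤ 2 * 4 ^ k * (b : ℝ) ^ 2 := by
  obtain ⟨U, s, h, hU, hcard, hPU, hlen⟩ := hP.exists_isSmoothFan_edgeLen_le hb
  obtain ⟨A, c, hbox⟩ :=
    hU.exists_supportRegion_subset_latticeBox_of_card_eq_add_five (hcard.trans hn) hlen
  have hℓ : 0 ≤ ![2 ^ k * (b : ℤ), 2 ^ (k + 1) * b] :=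
    Fin.forall_fin_two.2 ⟨show 0 ≤ 2 ^ k * (b : ℤ) by positivity,
      show 0 ≤ 2 ^ (k + 1) * (b : ℤ) by positivity⟩
  refine (volumeReal_le_of_subset_latticeBox hℓ (hPU.trans hbox)).trans_eq ?_
  rw [Fin.prod_univ_two, show (4 : ℝ) = 2 * 2 by norm_num, mul_pow]
  simp only [Matrix.cons_val_zero, Matrix.cons_val_one]
  push_cast
  ring

lemma volumeReal_le_of_five_le_numVertices (hP : IsSmoothPolygon P)
    (hb : IsGreatest (edgeLengths P) b) (hn : 5 ≤ numVertices P) :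
    volume.real P ≤ (4 : ℝ) ^ (numVertices P - 4) * (b : ℝ) ^ 2 - (numVertices P : ℝ) + 4 := by
  obtain ⟨k, hk⟩ := Nat.exists_eq_add_of_le' hn
  have hvol := hP.volumeReal_le_of_numVertices_eq_add_five hb.2 hk
  have hb_pos : (1 : ℝ) ≤ b := by
    obtain ⟨U, s, h, hU, -, -, hlen⟩ := hP.exists_isSmoothFan_edgeLen_le hb.2
    obtain ⟨u, hu⟩ := hU.nonempty
    exact_mod_cast (hlen u hu).1.trans (hlen u hu).2
  have hk_le : (k + 1 : ℝ) ≤ 4 ^ k := by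
    exact_mod_cast Nat.succ_le_of_lt (k.lt_pow_self (by norm_num))
  have hpow : (4 : ℝ) ^ k ≤ 4 ^ k * (b : ℝ) ^ 2 :=
    le_mul_of_one_le_right (by positivity) (one_le_pow₀ hb_pos)
  rw [hk, show k + 5 - 4 = k + 1 by omega, pow_succ]
  push_cast
  linarith

end IsSmoothPolygon

/-! ### Finiteness -/

namespace IsLatticePolygon

variable {P F : Set (Fin 2 → ℝ)}

lemma finrank_vectorSpan (hP : IsLatticePolygon P) : Module.finrank ℝ (vectorSpan ℝ P) = 2 := by
  rw [← direction_affineSpan, hP.2, AffineSubspace.direction_top, finrank_top,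
    Module.finrank_fin_fun]

lemma subset_frontier (hP : IsLatticePolygon P) (hF : IsExposed ℝ P F)
    (hdim : Module.finrank ℝ (vectorSpan ℝ F) ≠ 2) : F ⊆ frontier P :=
  subset_frontier_of_isExposed hF fun h => hdim (h ▸ hP.finrank_vectorSpan)

lemma finite_frontier_inter_intLattice (hP : IsLatticePolygon P) :
    (frontier P ∩ intLattice 2).Finite :=
  (finite_inter_intLattice hP.1.isCompact).subset
    (Set.inter_subset_inter_left _ hP.1.isCompact.isClosed.frontier_subset)

lemma numVertices_le_numBoundaryLatticePoints (hP : IsLatticePolygon P) :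
    numVertices P ≤ numBoundaryLatticePoints P := by
  refine Set.ncard_le_ncard (fun v hv => ⟨?_, hP.1.extremePoints_subset_intLattice hv⟩)
    hP.finite_frontier_inter_intLattice
  refine hP.subset_frontier (hP.1.isFace_singleton hv).2 ?_ (Set.mem_singleton v)
  rw [vectorSpan_singleton, finrank_bot]
  norm_num

lemma edgeLength_le (hP : IsLatticePolygon P) {l : ℕ} (hl : l ∈ edgeLengths P) :
    l ≤ numBoundaryLatticePoints P - 1 := by
  obtain ⟨F, hF, rfl⟩ := hl
  have hsub : F ⊆ frontier P := hP.subset_frontier hF.1.2 (by rw [hF.2]; norm_num)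
  exact Nat.sub_le_sub_right (Set.ncard_le_ncard (Set.inter_subset_inter_left _ hsub)
    hP.finite_frontier_inter_intLattice) 1

end IsLatticePolygon

lemma IsSmoothPolygon.exists_subset_latticeBox {P : Set (Fin 2 → ℝ)} (hP : IsSmoothPolygon P) :
    ∃ A c, P ⊆ latticeBox A c fun _ =>
      2 ^ numBoundaryLatticePoints P * numBoundaryLatticePoints P := by
  obtain ⟨U, s, h, hU, hcard, hPU, hlen⟩ :=
    hP.exists_isSmoothFan_edgeLen_le (b := numBoundaryLatticePoints P)
      fun l hl => (hP.1.edgeLength_le hl).trans (Nat.sub_le _ 1)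
  obtain ⟨A, c, hbox⟩ := hU.exists_supportRegion_subset_latticeBox hlen
  refine ⟨A, c, (hPU.trans hbox).trans (latticeBox_mono A c fun _ => ?_)⟩
  rw [hcard]
  gcongr
  · norm_num
  · exact hP.1.numVertices_le_numBoundaryLatticePoints

section IntegralEquivalence

variable {d : ℕ} {P Q : Set (Fin d → ℝ)}

lemma integrallyEquivalent_of_image_eq (χ : (Fin d → ℝ) ≃ᵃ[ℝ] Fin d → ℝ)
    (hχ : ∀ x, χ x ∈ intLattice d ↔ x ∈ intLattice d) (h : χ '' P = Q) :
    IntegrallyEquivalent P Q := by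
  refine ⟨χ, ?_, h⟩
  have hspan : χ '' (affineSpan ℝ P) = affineSpan ℝ Q := by
    rw [← h]
    exact congrArg SetLike.coe (AffineSubspace.map_span (χ : (Fin d → ℝ) →ᵃ[ℝ] Fin d → ℝ) P)
  have hlattice : χ '' intLattice d = intLattice d :=
    (congrArg (χ '' ·) (Set.ext hχ : χ ⁻¹' intLattice d = intLattice d)).symm.trans
      (Set.image_preimage_eq _ χ.surjective)
  rw [← hspan]
  nth_rw 2 [← hlattice]
  rw [← Set.image_inter χ.injective]
  exact χ.injective.injOn.bijOn_image

lemma IsLatticePolytope.exists_affineEquiv (hP : IsLatticePolytope P)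
    {A : Matrix.SpecialLinearGroup (Fin d) ℤ} {c ℓ : Fin d → ℤ} (hbox : P ⊆ latticeBox A c ℓ) :
    ∃ φ : (Fin d → ℝ) ≃ᵃ[ℝ] Fin d → ℝ, (∀ x, φ x ∈ intLattice d ↔ x ∈ intLattice d) ∧
      ∃ W ⊆ Set.Icc 0 (latticeEmb ℓ) ∩ intLattice d, convexHull ℝ W = φ '' P := by
  set φ := (unimodularMap A).toAffineEquiv.trans
    (AffineEquiv.constVAdd ℝ (Fin d → ℝ) (latticeEmb (-c)))
  have hφ : ∀ x, φ x = latticeEmb (-c) + unimodularMap A x := fun _ => rfl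
  have hφL : ∀ x, φ x ∈ intLattice d ↔ x ∈ intLattice d := fun x => by
    rw [hφ, ← unimodularMap_mem_intLattice_iff A (x := x)]
    exact latticeEmb.range.add_mem_cancel_left ⟨-c, rfl⟩
  have hφP : φ '' P ⊆ Set.Icc 0 (latticeEmb ℓ) := by
    rintro _ ⟨x, hx, rfl⟩
    obtain ⟨hlo, hhi⟩ := hbox hx
    rw [hφ, map_neg, neg_add_eq_sub]
    exact ⟨sub_nonneg.2 hlo, sub_le_iff_le_add'.2 (map_add latticeEmb c ℓ ▸ hhi)⟩
  refine ⟨φ, hφL, φ '' P.extremePoints ℝ, ?_, ?_⟩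
  · rintro _ ⟨v, hv, rfl⟩
    exact ⟨hφP ⟨v, hv.1, rfl⟩, (hφL v).2 (hP.extremePoints_subset_intLattice hv)⟩
  · have h := (φ : (Fin d → ℝ) →ᵃ[ℝ] Fin d → ℝ).image_convexHull (P.extremePoints ℝ)
    rw [hP.convexHull_extremePoints] at h
    exact h.symm

lemma exists_finite_representatives {𝒞 : Set (Set (Fin d → ℝ))} {ℓ : Fin d → ℤ}
    (h𝒞 : ∀ P ∈ 𝒞, IsLatticePolytope P ∧ ∃ A c, P ⊆ latticeBox A c ℓ) :
    ∃ T ⊆ 𝒞, T.Finite ∧ ∀ P ∈ 𝒞, ∃ Q ∈ T, IntegrallyEquivalent P Q := by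
  have hnormalize : ∀ P ∈ 𝒞, ∃ φ : (Fin d → ℝ) ≃ᵃ[ℝ] Fin d → ℝ,
      (∀ x, φ x ∈ intLattice d ↔ x ∈ intLattice d) ∧
        ∃ W ⊆ Set.Icc 0 (latticeEmb ℓ) ∩ intLattice d, convexHull ℝ W = φ '' P := fun P hP => by
    obtain ⟨hP, A, c, hbox⟩ := h𝒞 P hP
    exact hP.exists_affineEquiv hbox
  choose! φ hφ W hW hφW using hnormalize
  set f : Set (Fin d → ℝ) → Set (Fin d → ℝ) := fun P => φ P '' P
  have hfin : (f '' 𝒞).Finite := by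
    have hgrid := finite_inter_intLattice (isCompact_Icc (a := 0) (b := latticeEmb ℓ))
    refine (hgrid.finite_subsets.image
      (convexHull ℝ : Set (Fin d → ℝ) → Set (Fin d → ℝ))).subset ?_
    rintro _ ⟨P, hP, rfl⟩
    exact ⟨W P, hW P hP, hφW P hP⟩
  obtain ⟨T, hT, hbij⟩ := Set.exists_subset_bijOn 𝒞 f
  refine ⟨T, hT, hbij.finite_iff_finite.2 hfin, fun P hP => ?_⟩
  obtain ⟨Q, hQ, hQP⟩ := hbij.surjOn (Set.mem_image_of_mem f hP)
  refine ⟨Q, hQ, integrallyEquivalent_of_image_eq ((φ P).trans (φ Q).symm) (fun x => ?_) ?_⟩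
  · rw [← hφ Q (hT hQ), AffineEquiv.trans_apply, AffineEquiv.apply_symm_apply, hφ P hP]
  · rw [AffineEquiv.coe_trans, Set.image_comp, show φ P '' P = φ Q '' Q from hQP.symm,
      Set.image_image]
    simp only [AffineEquiv.symm_apply_apply, Set.image_id']

end IntegralEquivalence

theorem mainTheorem8 :
    (∀ N : ℕ, ∃ T : Set (Set (Fin 2 → ℝ)), T.Finite ∧
      (∀ Q ∈ T, IsSmoothPolygon Q ∧ numBoundaryLatticePoints Q = N + 1) ∧
      ∀ P : Set (Fin 2 → ℝ), IsSmoothPolygon P → numBoundaryLatticePoints P = N + 1 →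
        ∃ Q ∈ T, IntegrallyEquivalent P Q) ∧
    (∀ P : Set (Fin 2 → ℝ), IsSmoothPolygon P →
      ∃ b : ℕ, IsGreatest (edgeLengths P) b ∧
        (numVertices P = 3 → volume.real P ≤ (1 / 2 : ℝ) * (b : ℝ) ^ 2) ∧
        (numVertices P = 4 → volume.real P ≤ (b : ℝ) ^ 2) ∧
        (5 ≤ numVertices P →
          volume.real P ≤
            (4 : ℝ) ^ (numVertices P - 4) * (b : ℝ) ^ 2 - (numVertices P : ℝ) + 4)) := by
  constructor
  · intro N
    obtain ⟨T, hT, hfin, hrep⟩ := exists_finite_representatives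
      (𝒞 := {P | IsSmoothPolygon P ∧ numBoundaryLatticePoints P = N + 1})
      fun P hP => ⟨hP.1.1.1, hP.2 ▸ hP.1.exists_subset_latticeBox⟩
    exact ⟨T, hfin, fun Q hQ => hT hQ, fun P hP hN => hrep P ⟨hP, hN⟩⟩
  · intro P hP
    obtain ⟨b, hb⟩ := hP.exists_isGreatest_edgeLengths
    exact ⟨b, hb, hP.volumeReal_le_of_numVertices_eq_three hb.2,
      hP.volumeReal_le_of_numVertices_eq_four hb.2, hP.volumeReal_le_of_five_le_numVertices hb⟩
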